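/- A finite loop-free process is a state $p$ of a finite labelled transition system $(P,A,\to)$, with $P$ finite, $A$ finite and non-empty and ${\to}\subseteq P\times A\times P$, in which no state can be reached from itself by a non-empty sequence of transitions. Formulae of Hennessy–Milner logic over $A$ are built from $\mathbf{tt}$, $\mathbf{ff}$, $\wedge$, $\vee$, $\langle a\rangle$, $[a]$, $\neg$ ($a\in A$), with the usual satisfaction relation $\models$. The following fragments are considered: - $\mathcal L_{1S}$: $\varphi ::= \mathbf{tt}\mid\mathbf{ff}\mid\varphi\wedge\varphi\mid\varphi\vee\varphi\mid\langle a\rangle\varphi$; - $\mathcal L_{(n+1)S}$, $n\ge 1$: the same grammar with the additional clause $\neg\psi$, where $\psi\in\mathcal L_{nS}$; - $\mathcal L_{CS}$: the grammar of $\mathcal L_{1S}$ with the additional formula $\mathbf 0=\bigwedge_{a\in A}[a]\mathbf{ff}$; - $\mathcal L_{RS}$: the grammar of $\mathcal L_{1S}$ with the additional formulae $[a]\mathbf{ff}$, $a\in A$; - $\mathcal L_{BS}$: all formulae. For $\mathcal L$ one of these logics and a process $p$, let $\mathcal L(p)=\{\varphi\in\mathcal L : p\models\varphi\}$. A formula $\varphi$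 is characteristic for $p$ within $\mathcal L$ if $\varphi\in\mathcal L$ and, for every finite loop-free process $q$ over the same action set, $q\models\varphi$ if and only if $\mathcal L(p)\subseteq\mathcal L(q)$. A formula is given in declarative form if it is given by an acyclic system of equations $X_i=\varphi_i$, $0\le i<m$, where each $\varphi_i$ is a formula that may contain the variables $X_0,\dots,X_{m-1}$, together with a distinguished variable; the formula given is the value of the distinguished variable in the unique solution of the system. **Proposition.** For every $X\in\{nS : n\ge 1\}\cup\{CS,RS,BS\}$ there is a polynomial-time algorithm (a deterministic Turing machine) that, given a finite non-empty action set $A$, a finite loop-free labelled transition system over $A$ and a state $p$ of it, outputs a system of equations that is a declarative form of a formula characteristic for $p$ within $\mathcal L_X$. The running time is polynomial in the length of the input, that is, in $|P|+|{\to}|+|A|$; the polynomial may depend on $X$. -/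

import Mathlib

namespace CharForm

/-- A finite labelled transition system over the action set `A = {0, …, k-1}`, with state
set `{0, …, n-1}`. -/
structure PreLTS (k : ℕ) where
  n : ℕ
  trans : Fin n → Fin k → Fin n → Bool

/-- `S.Steps s t s'`: there is a sequence of transitions labelled with `t` from `s` to `s'`. -/
def PreLTS.Steps {k : ℕ} (S : PreLTS k) (s : Fin S.n) : List (Fin k) → Fin S.n → Prop
  | [], s' => s = s'
  | a :: t, s' => ∃ r, S.trans s a r = true ∧ PreLTS.Steps S r t s'

/-- A finite loop-free labelled transition system over the actions `{0, …, k-1}`: a nonempty trace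
never leads from a state to itself. -/
structure LTS (k : ℕ) extends PreLTS k where
  loopFree : ∀ s t, toPreLTS.Steps s t s → t = []

/-- Formulae of Hennessy-Milner logic over the actions `{0, …, k-1}`, which may contain formula
variables from `V`. -/
inductive Form (k : ℕ) (V : Type) : Type
  | tt : Form k V
  | ff : Form k V
  | and : Form k V → Form k V → Form k V
  | or : Form k V → Form k V → Form k V
  | dia : Fin k → Form k V → Form k V
  | box : Fin k → Form k V → Form k V
  | neg : Form k V → Form k V
  | var : V → Form k V

/-- Formulae of Hennessy-Milner logic in explicit form: no formula variables. -/
abbrev HML (k : ℕ) : Type := Form k Empty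

/-- The satisfaction relation `s ⊨ φ`. -/
def Sat {k : ℕ} (S : LTS k) : Fin S.n → HML k → Prop
  | _, .tt => True
  | _, .ff => False
  | s, .and φ ψ => Sat S s φ ∧ Sat S s ψ
  | s, .or φ ψ => Sat S s φ ∨ Sat S s ψ
  | s, .dia a φ => ∃ r, S.trans s a r = true ∧ Sat S r φ
  | s, .box a φ => ∀ r, S.trans s a r = true → Sat S r φ
  | s, .neg φ => ¬ Sat S s φ
  | _, .var v => v.elim

/-- The formula `𝟎`, the conjunction of `[a]ff` over all actions `a`. -/
def zeroForm (k : ℕ) : HML k :=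
  (List.finRange k).foldr (fun a φ => .and (.box a .ff) φ) .tt

/-- The grammar of the logic for `n`-nested simulation, `n ≥ 1`; for `n = 1` this is the logic for
simulation, which has no negation. -/
inductive NestedLogic (k : ℕ) : ℕ → HML k → Prop
  | tt (n) : NestedLogic k n .tt
  | ff (n) : NestedLogic k n .ff
  | and {n φ ψ} : NestedLogic k n φ → NestedLogic k n ψ → NestedLogic k n (.and φ ψ)
  | or {n φ ψ} : NestedLogic k n φ → NestedLogic k n ψ → NestedLogic k n (.or φ ψ)
  | dia {n φ} (a) : NestedLogic k n φ → NestedLogic k n (.dia a φ)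
  | neg {n φ} : 1 ≤ n → NestedLogic k n φ → NestedLogic k (n + 1) (.neg φ)

/-- The grammar of the logic for complete simulation. -/
inductive CSLogic (k : ℕ) : HML k → Prop
  | tt : CSLogic k .tt
  | ff : CSLogic k .ff
  | and {φ ψ} : CSLogic k φ → CSLogic k ψ → CSLogic k (.and φ ψ)
  | or {φ ψ} : CSLogic k φ → CSLogic k ψ → CSLogic k (.or φ ψ)
  | dia {φ} (a) : CSLogic k φ → CSLogic k (.dia a φ)
  | zero : CSLogic k (zeroForm k)

/-- The grammar of the logic for ready simulation. -/
inductive RSLogic (k : ℕ) : HML k → Prop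
  | tt : RSLogic k .tt
  | ff : RSLogic k .ff
  | and {φ ψ} : RSLogic k φ → RSLogic k ψ → RSLogic k (.and φ ψ)
  | or {φ ψ} : RSLogic k φ → RSLogic k ψ → RSLogic k (.or φ ψ)
  | dia {φ} (a) : RSLogic k φ → RSLogic k (.dia a φ)
  | boxff (a) : RSLogic k (.box a .ff)

/-- The semantics: `n`-nested simulation (`n ≥ 1`), complete simulation, ready simulation,
bisimilarity. -/
inductive Semantics : Type
  | nS (n : ℕ+)
  | CS
  | RS
  | BS

/-- The logic of a semantics, over the actions `{0, …, k-1}`. -/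
def Semantics.logic (k : ℕ) : Semantics → Set (HML k)
  | .nS n => {φ | NestedLogic k n φ}
  | .CS => {φ | CSLogic k φ}
  | .RS => {φ | RSLogic k φ}
  | .BS => Set.univ

/-- `φ` is characteristic within `L` for the process `p` of the system `S`: `φ ∈ L`, and the
processes `q` that satisfy `φ` are exactly those with `L(p) ⊆ L(q)`. Here `q` ranges over all states
of all finite loop-free systems over the same action set. -/
def IsCharacteristic {k : ℕ} (L : Set (HML k)) (S : LTS k) (p : Fin S.n) (φ : HML k) : Prop :=
  φ ∈ L ∧ ∀ (T : LTS k) (q : Fin T.n),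
    Sat T q φ ↔ {ψ | ψ ∈ L ∧ Sat S p ψ} ⊆ {ψ | ψ ∈ L ∧ Sat T q ψ}

/-- Simultaneous substitution for the formula variables. -/
def Form.subst {k : ℕ} {V W : Type} (σ : V → Form k W) : Form k V → Form k W
  | .tt => .tt
  | .ff => .ff
  | .and φ ψ => .and (φ.subst σ) (ψ.subst σ)
  | .or φ ψ => .or (φ.subst σ) (ψ.subst σ)
  | .dia a φ => .dia a (φ.subst σ)
  | .box a φ => .box a (φ.subst σ)
  | .neg φ => .neg (φ.subst σ)
  | .var v => σ v

/-- The formula variable `v` occurs in the formula. -/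
def Form.Occurs {k : ℕ} {V : Type} (v : V) : Form k V → Prop
  | .tt => False
  | .ff => False
  | .and φ ψ => φ.Occurs v ∨ ψ.Occurs v
  | .or φ ψ => φ.Occurs v ∨ ψ.Occurs v
  | .dia _ φ => φ.Occurs v
  | .box _ φ => φ.Occurs v
  | .neg φ => φ.Occurs v
  | .var w => w = v

/-- A system of equations `X_i = rhs i`, one for each of the variables `X_0, …, X_{m-1}`, with a
distinguished variable `X_root`. -/
structure EqSystem (k : ℕ) where
  m : ℕ
  rhs : Fin m → Form k (Fin m)
  root : Fin m

/-- The system is a declarative form of the formula `φ`: the equations do not depend on one another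
cyclically, and `φ` is the value of the distinguished variable in the (then unique) solution. -/
def EqSystem.IsDeclFormOf {k : ℕ} (D : EqSystem k) (φ : HML k) : Prop :=
  WellFounded (fun j i : Fin D.m => (D.rhs i).Occurs j) ∧
    ∃ σ : Fin D.m → HML k, (∀ i, σ i = (D.rhs i).subst σ) ∧ σ D.root = φ

/-- The symbols used to write down a system of equations. Numbers are written in unary, as a block of
`one` closed by `endnum`; every equation starts with `eqn`. -/
inductive OutSym : Type
  | tt | ff | and | or | dia | box | neg | var | eqn | one | endnum

/-- A number in unary. -/
def encodeNum (i : ℕ) : List OutSym := List.replicate i .one ++ [.endnum]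

/-- A right-hand side, in prefix notation. -/
def Form.encode {k m : ℕ} : Form k (Fin m) → List OutSym
  | .tt => [.tt]
  | .ff => [.ff]
  | .and φ ψ => .and :: (φ.encode ++ ψ.encode)
  | .or φ ψ => .or :: (φ.encode ++ ψ.encode)
  | .dia a φ => .dia :: (encodeNum a ++ φ.encode)
  | .box a φ => .box :: (encodeNum a ++ φ.encode)
  | .neg φ => .neg :: φ.encode
  | .var i => .var :: encodeNum i

/-- A system of equations as a word: the index of the distinguished variable, then the right-hand
sides in the order of the variables that they define. -/
def EqSystem.encode {k : ℕ} (D : EqSystem k) : List OutSym :=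
  encodeNum D.root ++ (List.finRange D.m).flatMap (fun i => .eqn :: (D.rhs i).encode)

/-- An input: a nonempty finite action set, a finite loop-free system over it, and a process
(state) of that system. -/
structure Input where
  k : ℕ
  k_pos : 0 < k
  lts : LTS k
  proc : Fin lts.n

/-- An input as a binary word: the number of actions, the number of states and the index of the
process in unary (a block of `true` closed by `false`), then the table of the transition relation,
one bit for each triple (source, action, target) in lexicographic order. -/
def Input.encode (p : Input) : List Bool :=
  List.replicate p.k true ++ [false] ++
    (List.replicate p.lts.n true ++ [false] ++
      (List.replicate (p.proc : ℕ) true ++ [false] ++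
        (List.finRange p.lts.n).flatMap (fun s =>
          (List.finRange p.k).flatMap (fun a =>
            (List.finRange p.lts.n).map (fun r => p.lts.trans s a r)))))

/-- The length of the input word is polynomial in the number of states plus the number of
actions. -/
theorem Input.length_encode (p : Input) :
    p.encode.length = p.k + p.lts.n + p.proc + 3 + p.lts.n * p.k * p.lts.n := by
  simp [Input.encode, List.length_flatMap]
  ring

end CharForm

/-! Each logic determines a simulation-like preorder, and a formula characteristic for `s` has to
say that the process at hand lies above `s`. In a loop-free system this is a recursion along the
transitions: `q` lies above `s` if every move of `s` to some `r` is answered by a move of `q` to a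
process above `r` (`diaRow`), and a side condition holds. The side condition is `[a]ff` for the
disabled actions (RS), `𝟎` at deadlocked states (CS), or a condition in the reverse direction (BS,
and nested simulation from level two on).

For bisimilarity the reverse condition is the negation of "some move of `q` has no counterpart in
`s`" (`muRow`). For nested simulation the levels alternate between formulae for "above `s`" and
formulae for "not below `s`". Each level then refers to the previous one under a single negation,
which is what the grammar permits (`nestedSpec_of_solves`).

Written out, such formulae can be exponentially large. As equations they are small: there is one
variable for each state and each member of a list of families whose number depends on the semantics
only. The system is acyclic for the lexicographic order of states, along the transitions, and
families (`familySystem_wellFounded`).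

On the machine side, all these systems are instances of one kind of template. In prefix notation a
right-nested conjunction is the concatenation of the prefixes of its conjuncts (`encode_foldr`), so
an equation can be written while one row of the transition table is read from left to right. A
single program, with the templates as parameter, is verified together with its running time
(`runs_mainProg`). It is written in a small structured language, whose compilation to `FinTM2`
preserves step counts up to one final step (`Exec.reach`, `Exec.machine_evals`).
`exists_of_families` joins the two sides. -/

/-! ## Structured programs and their compilation to Turing machines -/

namespace CharForm

open Turing Function

/-- Structured programs on a family of stacks with alphabets `Γ k`. -/
inductive Prog {K : Type} (Γ : K → Type) : Type
  | skip : Prog Γ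
  | push (k : K) (c : Γ k) : Prog Γ
  | seq : Prog Γ → Prog Γ → Prog Γ
  /-- Pop the stack `k` and branch on the result. -/
  | read (k : K) (body : Option (Γ k) → Prog Γ) : Prog Γ
  /-- Pop the stack `k` until it is empty or a symbol with `isEnd` is popped, and execute `body` for
  every other symbol that is popped. -/
  | loop (k : K) (isEnd : Γ k → Bool) (body : Γ k → Prog Γ) : Prog Γ

namespace Prog

variable {K : Type} [DecidableEq K] {Γ : K → Type}

/-- `Exec p S t S'`: the program `p`, started with the stacks `S`, ends after `t` steps with the
stacks `S'`. -/
inductive Exec : Prog Γ → (∀ k, List (Γ k)) → ℕ → (∀ k, List (Γ k)) → Prop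
  | skip (S) : Exec .skip S 1 S
  | push (k c S) : Exec (.push k c) S 1 (update S k (c :: S k))
  | seq {p q S S' S'' t t'} : Exec p S t S' → Exec q S' t' S'' → Exec (.seq p q) S (t + t') S''
  | read {k body S S' t} : Exec (body (S k).head?) (update S k (S k).tail) t S' →
      Exec (.read k body) S (t + 1) S'
  | loop_nil {k isEnd body S} : S k = [] → Exec (.loop k isEnd body) S 1 S
  | loop_end {k isEnd body S x l} : S k = x :: l → isEnd x = true →
      Exec (.loop k isEnd body) S 1 (update S k l)
  | loop_cons {k isEnd body S S' S'' x l t t'} : S k = x :: l → isEnd x = false →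
      Exec (body x) (update S k l) t S' → Exec (.loop k isEnd body) S' t' S'' →
      Exec (.loop k isEnd body) S (t + 1 + t') S''

/-- A step pushes at most one symbol. This later bounds the length of the output by the time spent
on it, with no separate estimate of its size. -/
theorem Exec.length_le {p : Prog Γ} {S S' : ∀ k, List (Γ k)} {t : ℕ} (h : Exec p S t S') (k : K) :
    (S' k).length ≤ (S k).length + t := by
  induction h with
  | skip S => simp
  | push k' c S =>
    rcases eq_or_ne k k' with rfl | hk
    · simp
    · simp [update_of_ne hk]
  | seq _ _ ih₁ ih₂ => omega
  | @read k' body S S' t _ ih =>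
    rcases eq_or_ne k k' with rfl | hk
    · simp only [update_self, List.length_tail] at ih; omega
    · rw [update_of_ne hk] at ih; omega
  | loop_nil => simp
  | @loop_end k' isEnd body S x l hS _ =>
    rcases eq_or_ne k k' with rfl | hk
    · simp [hS]; omega
    · simp [update_of_ne hk]
  | @loop_cons k' isEnd body S S' S'' x l t t' hS _ _ _ ih₁ ih₂ =>
    rcases eq_or_ne k k' with rfl | hk
    · simp only [update_self] at ih₁; simp only [hS, List.length_cons]; omega
    · rw [update_of_ne hk] at ih₁; omega

/-- The labels of the compiled program. -/
def Lbl : Prog Γ → Type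
  | .skip => Unit
  | .push _ _ => Unit
  | .seq p q => p.Lbl ⊕ q.Lbl
  | .read k body => Option (Σ o : Option (Γ k), (body o).Lbl)
  | .loop k _ body => Option (Σ x : Γ k, (body x).Lbl)

instance finite_lbl [∀ k, Finite (Γ k)] (p : Prog Γ) : Finite p.Lbl := by
  induction p with
  | skip => exact inferInstanceAs (Finite Unit)
  | push => exact inferInstanceAs (Finite Unit)
  | seq p q _ _ => exact inferInstanceAs (Finite (p.Lbl ⊕ q.Lbl))
  | read k body _ => exact inferInstanceAs (Finite (Option (Σ o : Option (Γ k), (body o).Lbl)))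
  | loop k _ body _ => exact inferInstanceAs (Finite (Option (Σ x : Γ k, (body x).Lbl)))

/-- The label at which the compiled program starts. -/
def entry : (p : Prog Γ) → p.Lbl
  | .skip => ()
  | .push _ _ => ()
  | .seq p _ => .inl p.entry
  | .read _ _ => none
  | .loop _ _ _ => none

/-- The internal state of the compiled program: the last symbol that was popped. -/
abbrev Mem (Γ : K → Type) : Type := Option (Σ k, Γ k)

/-- The symbol of the alphabet `Γ k` that is held in the internal state. -/
def Mem.get (k : K) : Mem Γ → Option (Γ k)
  | none => none
  | some ⟨k', x⟩ => if h : k' = k then some (h ▸ x) else none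

@[simp] theorem Mem.get_map (k : K) (o : Option (Γ k)) : Mem.get k (o.map (Sigma.mk k)) = o := by
  cases o <;> simp [Mem.get]

/-- The code of the compiled program; `e` places its labels among those of the whole machine, and
the program is left by a jump to `out`. -/
def code {Λ : Type} : (p : Prog Γ) → (p.Lbl → Λ) → Λ → p.Lbl → TM2.Stmt Γ Λ (Mem Γ)
  | .skip, _, out, _ => .goto fun _ => out
  | .push k c, _, out, _ => .push k (fun _ => c) (.goto fun _ => out)
  | .seq p q, e, _, .inl l => p.code (fun l => e (.inl l)) (e (.inr q.entry)) l
  | .seq _ q, e, out, .inr l => q.code (fun l => e (.inr l)) out l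
  | .read k body, e, _, none => .pop k (fun _ o => o.map (Sigma.mk k))
      (.goto fun v => e (some ⟨v.get k, (body (v.get k)).entry⟩))
  | .read _ body, e, out, some ⟨o, l⟩ => (body o).code (fun l => e (some ⟨o, l⟩)) out l
  | .loop k isEnd body, e, out, none => .pop k (fun _ o => o.map (Sigma.mk k))
      (.goto fun v => match v.get k with
        | none => out
        | some x => if isEnd x then out else e (some ⟨x, (body x).entry⟩))
  | .loop _ _ body, e, _, some ⟨x, l⟩ => (body x).code (fun l => e (some ⟨x, l⟩)) (e none) l

/-- The machine `M` gets from the configuration `c` to `c'` in `t` steps. -/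
def Reach {Λ σ : Type} (M : Λ → TM2.Stmt Γ Λ σ) (t : ℕ) (c c' : TM2.Cfg Γ Λ σ) : Prop :=
  (flip bind (TM2.step M))^[t] (some c) = some c'

theorem Reach.trans {Λ σ : Type} {M : Λ → TM2.Stmt Γ Λ σ} {t t' : ℕ} {c c' c'' : TM2.Cfg Γ Λ σ}
    (h : Reach M t c c') (h' : Reach M t' c' c'') : Reach M (t + t') c c'' := by
  unfold Reach at *
  rw [add_comm, iterate_add_apply, h, h']

theorem Reach.of_step {Λ σ : Type} {M : Λ → TM2.Stmt Γ Λ σ} (l : Λ) (v : σ)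
    (S : ∀ k, List (Γ k)) : Reach M 1 ⟨some l, v, S⟩ (TM2.stepAux (M l) v S) := rfl

/-- The embedding `e` and the exit `out` are quantified inside the induction because a subprogram is
placed at other labels and left through another exit than the whole. The internal state `v` may be
arbitrary, since every pop overwrites it before a jump consults it. -/
theorem Exec.reach {Λ : Type} {M : Λ → TM2.Stmt Γ Λ (Mem Γ)} {p : Prog Γ}
    {S S' : ∀ k, List (Γ k)} {t : ℕ} (h : Exec p S t S') :
    ∀ (e : p.Lbl → Λ) (out : Λ), (∀ l, M (e l) = p.code e out l) → ∀ v : Mem Γ,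
      ∃ v', Reach M t ⟨some (e p.entry), v, S⟩ ⟨some out, v', S'⟩ := by
  induction h with
  | skip S =>
    intro e out hM v
    refine ⟨v, ?_⟩
    have := Reach.of_step (M := M) (e Prog.skip.entry) v S
    rwa [hM] at this
  | push k c S =>
    intro e out hM v
    refine ⟨v, ?_⟩
    have := Reach.of_step (M := M) (e (Prog.push k c).entry) v S
    rwa [hM] at this
  | @seq p q S S' S'' t t' _ _ ih₁ ih₂ =>
    intro e out hM v
    obtain ⟨v₁, h₁⟩ := ih₁ (fun l => e (.inl l)) (e (.inr q.entry)) (fun l => hM (.inl l)) v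
    obtain ⟨v₂, h₂⟩ := ih₂ (fun l => e (.inr l)) out (fun l => hM (.inr l)) v₁
    exact ⟨v₂, h₁.trans h₂⟩
  | @read k body S S' t _ ih =>
    intro e out hM v
    obtain ⟨v₁, h₁⟩ := ih (fun l => e (some ⟨_, l⟩)) out (fun l => hM (some ⟨_, l⟩))
      ((S k).head?.map (Sigma.mk k))
    refine ⟨v₁, ?_⟩
    have h₀ := Reach.of_step (M := M) (e (Prog.read k body).entry) v S
    rw [hM] at h₀
    -- The type of the second component depends on the first, so both must be replaced at once.
    have hg : ∀ o o', o = o' → (⟨o, (body o).entry⟩ : Σ o, (body o).Lbl) = ⟨o', (body o').entry⟩ := by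
      rintro _ _ rfl; rfl
    simp only [code, entry, TM2.stepAux] at h₀
    rw [hg _ _ (Mem.get_map k _)] at h₀
    rw [add_comm]
    exact h₀.trans h₁
  | @loop_nil k isEnd body S hS =>
    intro e out hM v
    refine ⟨none, ?_⟩
    have h₀ := Reach.of_step (M := M) (e (Prog.loop k isEnd body).entry) v S
    rw [hM] at h₀
    simp only [code, entry, TM2.stepAux, Mem.get_map, hS] at h₀
    have : update S k (List.tail []) = S := by rw [List.tail_nil, ← hS, update_eq_self]
    rwa [this] at h₀
  | @loop_end k isEnd body S x l hS hx =>
    intro e out hM v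
    refine ⟨some ⟨k, x⟩, ?_⟩
    have h₀ := Reach.of_step (M := M) (e (Prog.loop k isEnd body).entry) v S
    rw [hM] at h₀
    simp only [code, entry, TM2.stepAux, Mem.get_map, hS, List.head?_cons, hx, if_true] at h₀
    exact h₀
  | @loop_cons k isEnd body S S' S'' x l t t' hS hx _ _ ih₁ ih₂ =>
    intro e out hM v
    obtain ⟨v₁, h₁⟩ := ih₁ (fun l => e (some ⟨x, l⟩)) (e none) (fun l => hM (some ⟨x, l⟩))
      (some ⟨k, x⟩)
    obtain ⟨v₂, h₂⟩ := ih₂ e out hM v₁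
    refine ⟨v₂, ?_⟩
    have h₀ := Reach.of_step (M := M) (e (Prog.loop k isEnd body).entry) v S
    rw [hM] at h₀
    simp only [code, entry, TM2.stepAux, Mem.get_map, hS, List.head?_cons, hx, Bool.false_eq_true,
      if_false] at h₀
    rw [add_comm t 1]
    exact (h₀.trans h₁).trans h₂

/-- The Turing machine that executes a program and halts. -/
noncomputable def machine [Fintype K] [∀ k, Finite (Γ k)] (p : Prog Γ) (k₀ k₁ : K) : FinTM2 :=
  letI := Fintype.ofFinite p.Lbl
  letI := Fintype.ofFinite (Mem Γ)
  letI := Fintype.ofFinite (Γ k₀)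
  { k₀ := k₀
    k₁ := k₁
    Γ := Γ
    Λ := Option p.Lbl
    main := some p.entry
    σ := Mem Γ
    initialState := none
    m := fun
      -- A halting configuration in the sense of `haltList` has the initial internal state, so the
      -- last popped symbol is erased. This accounts for the extra step in `Exec.machine_evals`.
      | none => .load (fun _ => none) .halt
      | some l => p.code some none l }

theorem Exec.machine_evals [Fintype K] [∀ k, Finite (Γ k)] {p : Prog Γ} {k₀ k₁ : K}
    {S S' : ∀ k, List (Γ k)} {t : ℕ} (h : Exec p S t S') :
    (flip bind (p.machine k₀ k₁).step)^[t + 1] (some ⟨some (some p.entry), none, S⟩) =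
      some ⟨none, none, S'⟩ := by
  obtain ⟨v, hv⟩ := h.reach (M := (p.machine k₀ k₁).m) some none (fun _ => rfl) none
  exact hv.trans (t' := 1) rfl

/-! ### Time bounds for structured programs -/

/-- The program ends within `T` steps. -/
def Runs (p : Prog Γ) (S : ∀ k, List (Γ k)) (T : ℕ) (S' : ∀ k, List (Γ k)) : Prop :=
  ∃ t ≤ T, Exec p S t S'

theorem Runs.mono {p : Prog Γ} {S S' : ∀ k, List (Γ k)} {T T' : ℕ} (h : Runs p S T S')
    (hT : T ≤ T') : Runs p S T' S' :=
  let ⟨t, ht, he⟩ := h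
  ⟨t, ht.trans hT, he⟩

theorem Runs.skip (S : ∀ k, List (Γ k)) : Runs .skip S 1 S := ⟨1, le_rfl, .skip S⟩

theorem Runs.push (k : K) (c : Γ k) (S : ∀ k, List (Γ k)) :
    Runs (.push k c) S 1 (update S k (c :: S k)) := ⟨1, le_rfl, .push k c S⟩

theorem Runs.push_of_eq {k : K} {c : Γ k} {S S' : ∀ k, List (Γ k)}
    (h : update S k (c :: S k) = S') : Runs (.push k c) S 1 S' := h ▸ Runs.push k c S

theorem Runs.seq {p q : Prog Γ} {S S' S'' : ∀ k, List (Γ k)} {T T' : ℕ} (h : Runs p S T S')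
    (h' : Runs q S' T' S'') : Runs (.seq p q) S (T + T') S'' :=
  let ⟨_, ht, he⟩ := h
  let ⟨_, ht', he'⟩ := h'
  ⟨_, add_le_add ht ht', .seq he he'⟩

/-- The head and the remaining store enter through equations, so that callers can supply them in the
form `St.store`; `Runs.loop_end` and `Runs.loop_cons` follow the same pattern. -/
theorem Runs.read {k : K} {body : Option (Γ k) → Prog Γ} {S S₁ S' : ∀ k, List (Γ k)} {T : ℕ}
    {o : Option (Γ k)} (ho : (S k).head? = o) (hu : update S k (S k).tail = S₁)
    (h : Runs (body o) S₁ T S') : Runs (.read k body) S (T + 1) S' := by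
  subst ho hu
  obtain ⟨t, ht, he⟩ := h
  exact ⟨t + 1, by omega, .read he⟩

theorem Runs.loop_nil {k : K} {isEnd : Γ k → Bool} {body : Γ k → Prog Γ} {S : ∀ k, List (Γ k)}
    (h : S k = []) : Runs (.loop k isEnd body) S 1 S := ⟨1, le_rfl, .loop_nil h⟩

theorem Runs.loop_end {k : K} {isEnd : Γ k → Bool} {body : Γ k → Prog Γ} {S S' : ∀ k, List (Γ k)}
    {x : Γ k} {l : List (Γ k)} (h : S k = x :: l) (hx : isEnd x = true) (hu : update S k l = S') :
    Runs (.loop k isEnd body) S 1 S' := ⟨1, le_rfl, hu ▸ .loop_end h hx⟩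

theorem Runs.loop_cons {k : K} {isEnd : Γ k → Bool} {body : Γ k → Prog Γ}
    {S S₁ S' S'' : ∀ k, List (Γ k)} {x : Γ k} {l : List (Γ k)} {T T' : ℕ} (h : S k = x :: l)
    (hx : isEnd x = false) (hu : update S k l = S₁) (hb : Runs (body x) S₁ T S')
    (hl : Runs (.loop k isEnd body) S' T' S'') : Runs (.loop k isEnd body) S (T + 1 + T') S'' := by
  subst hu
  obtain ⟨t, ht, he⟩ := hb
  obtain ⟨t', ht', he'⟩ := hl
  exact ⟨t + 1 + t', by omega, .loop_cons h hx he he'⟩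

end Prog

end CharForm

/-! ## A program that writes systems of equations -/

namespace CharForm

open Turing Function

/-- The unary counters of the program. For a loop over the actions, sources or targets, the counter
`…Done` holds the current index and `…Left` the number of iterations that are left. -/
inductive Ctr : Type
  | actLeft | actDone | srcLeft | srcDone | tgtLeft | tgtDone | size | proc | tmp | actFlag | srcFlag
  deriving DecidableEq

instance fintype_ctr : Fintype Ctr where
  elems := {.actLeft, .actDone, .srcLeft, .srcDone, .tgtLeft, .tgtDone, .size, .proc, .tmp, .actFlag,
    .srcFlag}
  complete c := by cases c <;> decide

/-- The stacks of the program: the unread and the read part of the input, the output in reverse, the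
output, and the counters. -/
inductive Stk : Type
  | inp | tab | rev | out
  | ctr (c : Ctr)
  deriving DecidableEq

instance fintype_stk : Fintype Stk where
  elems := {.inp, .tab, .rev, .out} ∪ Finset.univ.image .ctr
  complete k := by cases k <;> simp

/-- The alphabets of the stacks. -/
@[reducible] def Alph : Stk → Type
  | .inp => Bool
  | .tab => Bool
  | .rev => OutSym
  | .out => OutSym
  | .ctr _ => Unit

instance finite_outSym : Finite OutSym := by
  refine Set.finite_univ_iff.1 (Set.Finite.subset (Set.toFinite
    {.tt, .ff, .and, .or, .dia, .box, .neg, .var, .eqn, .one, .endnum}) ?_)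
  intro x _; cases x <;> simp

instance finite_alph (k : Stk) : Finite (Alph k) := by
  cases k
  · exact inferInstanceAs (Finite Bool)
  · exact inferInstanceAs (Finite Bool)
  · exact inferInstanceAs (Finite OutSym)
  · exact inferInstanceAs (Finite OutSym)
  · exact inferInstanceAs (Finite Unit)

/-- The contents of the stacks. -/
structure St where
  inp : List Bool
  tab : List Bool := []
  rev : List OutSym := []
  out : List OutSym := []
  actLeft : ℕ := 0
  actDone : ℕ := 0
  srcLeft : ℕ := 0
  srcDone : ℕ := 0
  tgtLeft : ℕ := 0
  tgtDone : ℕ := 0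
  size : ℕ := 0
  proc : ℕ := 0
  actFlag : Bool := false
  srcFlag : Bool := false

/-- A counter as a stack. -/
abbrev unary (n : ℕ) : List Unit := List.replicate n ()

/-- A flag as a stack. -/
def flag (b : Bool) : List Unit := if b then [()] else []

/-- The stacks with the given contents. -/
def St.store (s : St) : ∀ k, List (Alph k)
  | .inp => s.inp
  | .tab => s.tab
  | .rev => s.rev
  | .out => s.out
  | .ctr .actLeft => unary s.actLeft
  | .ctr .actDone => unary s.actDone
  | .ctr .srcLeft => unary s.srcLeft
  | .ctr .srcDone => unary s.srcDone
  | .ctr .tgtLeft => unary s.tgtLeft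
  | .ctr .tgtDone => unary s.tgtDone
  | .ctr .size => unary s.size
  | .ctr .proc => unary s.proc
  | .ctr .tmp => []
  | .ctr .actFlag => flag s.actFlag
  | .ctr .srcFlag => flag s.srcFlag

namespace St

variable (s : St)

/-- This lemma and its analogues for the other stacks replace updates of a dependent function by
updates of record fields, in which all later invariants are stated. The counter `tmp` has no field,
as it is empty except inside `emitOnes`. -/
theorem update_inp (l : List Bool) : update s.store .inp l = {s with inp := l}.store := by
  funext k; rcases k with _ | _ | _ | _ | c <;> [skip; skip; skip; skip; cases c] <;> rfl

theorem update_tab (l : List Bool) : update s.store .tab l = {s with tab := l}.store := by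
  funext k; rcases k with _ | _ | _ | _ | c <;> [skip; skip; skip; skip; cases c] <;> rfl

theorem update_rev (l : List OutSym) : update s.store .rev l = {s with rev := l}.store := by
  funext k; rcases k with _ | _ | _ | _ | c <;> [skip; skip; skip; skip; cases c] <;> rfl

theorem update_out (l : List OutSym) : update s.store .out l = {s with out := l}.store := by
  funext k; rcases k with _ | _ | _ | _ | c <;> [skip; skip; skip; skip; cases c] <;> rfl

theorem update_actLeft (n : ℕ) :
    update s.store (.ctr .actLeft) (unary n) = {s with actLeft := n}.store := by
  funext k; rcases k with _ | _ | _ | _ | c <;> [skip; skip; skip; skip; cases c] <;> rfl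

theorem update_actDone (n : ℕ) :
    update s.store (.ctr .actDone) (unary n) = {s with actDone := n}.store := by
  funext k; rcases k with _ | _ | _ | _ | c <;> [skip; skip; skip; skip; cases c] <;> rfl

theorem update_srcLeft (n : ℕ) :
    update s.store (.ctr .srcLeft) (unary n) = {s with srcLeft := n}.store := by
  funext k; rcases k with _ | _ | _ | _ | c <;> [skip; skip; skip; skip; cases c] <;> rfl

theorem update_srcDone (n : ℕ) :
    update s.store (.ctr .srcDone) (unary n) = {s with srcDone := n}.store := by
  funext k; rcases k with _ | _ | _ | _ | c <;> [skip; skip; skip; skip; cases c] <;> rfl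

theorem update_tgtLeft (n : ℕ) :
    update s.store (.ctr .tgtLeft) (unary n) = {s with tgtLeft := n}.store := by
  funext k; rcases k with _ | _ | _ | _ | c <;> [skip; skip; skip; skip; cases c] <;> rfl

theorem update_tgtDone (n : ℕ) :
    update s.store (.ctr .tgtDone) (unary n) = {s with tgtDone := n}.store := by
  funext k; rcases k with _ | _ | _ | _ | c <;> [skip; skip; skip; skip; cases c] <;> rfl

theorem update_size (n : ℕ) :
    update s.store (.ctr .size) (unary n) = {s with size := n}.store := by
  funext k; rcases k with _ | _ | _ | _ | c <;> [skip; skip; skip; skip; cases c] <;> rfl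

theorem update_proc (n : ℕ) :
    update s.store (.ctr .proc) (unary n) = {s with proc := n}.store := by
  funext k; rcases k with _ | _ | _ | _ | c <;> [skip; skip; skip; skip; cases c] <;> rfl

theorem update_actFlag (b : Bool) :
    update s.store (.ctr .actFlag) (flag b) = {s with actFlag := b}.store := by
  funext k; rcases k with _ | _ | _ | _ | c <;> [skip; skip; skip; skip; cases c] <;> rfl

theorem update_srcFlag (b : Bool) :
    update s.store (.ctr .srcFlag) (flag b) = {s with srcFlag := b}.store := by
  funext k; rcases k with _ | _ | _ | _ | c <;> [skip; skip; skip; skip; cases c] <;> rfl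

end St

/-! ### Templates for families of equations -/

/-- The values that can be written: the current action, source and target, the number of states, and
the process. -/
inductive Val : Type
  | act | src | tgt | size | proc

/-- The values that can be written, at some point of the computation. -/
structure Env where
  act : ℕ := 0
  src : ℕ := 0
  tgt : ℕ := 0
  size : ℕ
  proc : ℕ

def Env.val (e : Env) : Val → ℕ
  | .act => e.act
  | .src => e.src
  | .tgt => e.tgt
  | .size => e.size
  | .proc => e.proc

/-- A token of a template: a fixed symbol, or a block of `one` of given length. -/
inductive Tok : Type
  | sym (o : OutSym)
  | ones (v : Val)

def Tok.word (e : Env) : Tok → List OutSym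
  | .sym o => [o]
  | .ones v => List.replicate (e.val v) .one

/-- The word that is described by a list of tokens. -/
def word (e : Env) (l : List Tok) : List OutSym := l.flatMap (Tok.word e)

/-- A template for a family of equations, one for each state. -/
structure Template where
  /-- written at the start of an equation -/
  start : List Tok
  /-- written at the start of the block of an action -/
  pre : List Tok
  /-- written for every transition -/
  item : List Tok
  /-- written at the end of the block of an action, which may be enabled or not -/
  post : Bool → List Tok
  /-- written at the end of an equation, for a state that has a transition or not -/
  fin : Bool → List Tok

/-- The concatenation of the words for the members of a list, which may depend on their index. -/
def idxFlat {β γ : Type} (g : ℕ → β → List γ) : ℕ → List β → List γ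
  | _, [] => []
  | i, b :: l => g i b ++ idxFlat g (i + 1) l

theorem idxFlat_finRange {β γ : Type} (g : ℕ → β → List γ) {n : ℕ} (f : Fin n → β) (i : ℕ) :
    idxFlat g i ((List.finRange n).map f) =
      (List.finRange n).flatMap fun r : Fin n => g (i + (r : ℕ)) (f r) := by
  induction n generalizing i with
  | zero => simp [idxFlat]
  | succ n ih =>
    rw [List.finRange_succ, List.map_cons, List.map_map, idxFlat, ih (f ∘ Fin.succ),
      List.flatMap_cons, List.flatMap_map]
    simp [add_assoc, add_comm 1]

namespace Template

variable (T : Template)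

/-- `itemOut`, `blockOut` and `rowOut` specify what the three nested loops of the program write.
Each overrides the field of `e` that its own loop counts, so the value of that field in `e` is
irrelevant. -/
def itemOut (e : Env) (r : ℕ) (b : Bool) : List OutSym :=
  if b then word {e with tgt := r} T.item else []

def blockOut (e : Env) (a : ℕ) (bits : List Bool) : List OutSym :=
  word {e with act := a} T.pre ++ (idxFlat (T.itemOut {e with act := a}) 0 bits ++
    word {e with act := a} (T.post (bits.any id)))

def rowOut (e : Env) (s : ℕ) (row : List (List Bool)) : List OutSym :=
  word {e with src := s} T.start ++ (idxFlat (T.blockOut {e with src := s}) 0 row ++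
    word {e with src := s} (T.fin (row.any fun bits => bits.any id)))

/-- The equations that are written for a transition table. -/
def tableOut (e : Env) (table : List (List (List Bool))) : List OutSym :=
  idxFlat (T.rowOut e) 0 table

end Template

/-- The transition table of an input. -/
def Input.table (p : Input) : List (List (List Bool)) :=
  (List.finRange p.lts.n).map fun s => (List.finRange p.k).map fun a =>
    (List.finRange p.lts.n).map fun r => p.lts.trans s a r

/-- The system of equations that is described by a list of templates. -/
def templateOut (root : List Tok) (Ts : List Template) (p : Input) : List OutSym :=
  word ⟨0, 0, 0, p.lts.n, p.proc⟩ root ++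
    Ts.flatMap fun T => T.tableOut ⟨0, 0, 0, p.lts.n, p.proc⟩ p.table

/-! ### The program -/

open Prog

/-- Empty a stack. -/
abbrev clear (k : Stk) : Prog Alph := .loop k (fun _ => false) fun _ => .skip

/-- Move the contents of a counter to another counter. -/
abbrev move (c d : Ctr) : Prog Alph := .loop (.ctr c) (fun _ => false) fun _ => .push (.ctr d) ()

/-- Reading a counter destroys it, so a copy is built up in `tmp` while the block is written, and is
moved back afterwards. -/
def emitOnes (c : Ctr) : Prog Alph :=
  .seq (.loop (.ctr c) (fun _ => false) fun _ => .seq (.push .rev .one) (.push (.ctr .tmp) ()))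
    (move .tmp c)

def Val.ctr : Val → Ctr
  | .act => .actDone
  | .src => .srcDone
  | .tgt => .tgtDone
  | .size => .size
  | .proc => .proc

def emitTok : Tok → Prog Alph
  | .sym o => .push .rev o
  | .ones v => emitOnes v.ctr

/-- Write the word that is described by a list of tokens. -/
def emit : List Tok → Prog Alph
  | [] => .skip
  | t :: l => .seq (emitTok t) (emit l)

/-- The pop before the push keeps the height of the flag at one when it is set repeatedly. -/
def setFlag (c : Ctr) : Prog Alph := .read (.ctr c) fun _ => .push (.ctr c) ()

def itemBody (T : Template) : Option Bool → Prog Alph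
  -- This case does not arise on a valid input: the table has a bit for every iteration.
  | none => .skip
  | some false => .push .tab false
  | some true => .seq (.push .tab true)
      (.seq (emit T.item) (.seq (setFlag .actFlag) (setFlag .srcFlag)))

def itemStep (T : Template) : Prog Alph :=
  .seq (.read .inp (itemBody T)) (.push (.ctr .tgtDone) ())

/-- Write the part of an equation that belongs to the transitions with a given action. -/
abbrev itemLoop (T : Template) : Prog Alph :=
  .loop (.ctr .tgtLeft) (fun _ => false) fun _ => itemStep T

/-- Moving `tgtDone` back to `tgtLeft` rearms the loop over the targets for the next action, and
reading `actFlag` also resets it. `rowStep` does the same one level up. -/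
def blockStep (T : Template) : Prog Alph :=
  .seq (emit T.pre) <| .seq (itemLoop T) <| .seq (move .tgtDone .tgtLeft) <|
    .seq (.read (.ctr .actFlag) fun o => emit (T.post o.isSome)) (.push (.ctr .actDone) ())

/-- Write the blocks of the actions. -/
abbrev blockLoop (T : Template) : Prog Alph :=
  .loop (.ctr .actLeft) (fun _ => false) fun _ => blockStep T

def rowStep (T : Template) : Prog Alph :=
  .seq (emit T.start) <| .seq (blockLoop T) <| .seq (move .actDone .actLeft) <|
    .seq (.read (.ctr .srcFlag) fun o => emit (T.fin o.isSome)) (.push (.ctr .srcDone) ())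

/-- Write the equations of the states. -/
abbrev rowLoop (T : Template) : Prog Alph :=
  .loop (.ctr .srcLeft) (fun _ => false) fun _ => rowStep T

abbrev restore : Prog Alph := .loop .tab (fun _ => false) fun b => .push .inp b

/-- Write the equations of a template, in one pass over the transition table. -/
def pass (T : Template) : Prog Alph :=
  -- The bits that were read lie reversed on `tab`; `restore` reverses them again, so the next
  -- template finds the table intact.
  .seq (rowLoop T) <| .seq (move .srcDone .srcLeft) restore

def passes : List Template → Prog Alph
  | [] => .skip
  | T :: Ts => .seq (pass T) (passes Ts)

def isFalse (b : Bool) : Bool := !b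

/-- Read the number of actions, the number of states and the process. -/
def parse : Prog Alph :=
  .seq (.loop .inp isFalse fun _ => .push (.ctr .actLeft) ()) <|
    -- The number of states is needed three times: as a value to write, and as the number of
    -- iterations over sources and over targets.
    .seq (.loop .inp isFalse fun _ => .seq (.push (.ctr .size) ())
      (.seq (.push (.ctr .srcLeft) ()) (.push (.ctr .tgtLeft) ()))) <|
    .loop .inp isFalse fun _ => .push (.ctr .proc) ()

/-- `haltList` demands that all stacks but the output be empty. The output was collected in reverse,
so emptying `rev` onto `out` puts it in order. -/
def cleanup : Prog Alph :=
  .seq (clear .inp) <| .seq (clear (.ctr .actLeft)) <| .seq (clear (.ctr .srcLeft)) <|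
    .seq (clear (.ctr .tgtLeft)) <| .seq (clear (.ctr .size)) <| .seq (clear (.ctr .proc)) <|
    .loop .rev (fun _ => false) fun o => .push .out o

def mainProg (root : List Tok) (Ts : List Template) : Prog Alph :=
  .seq parse <| .seq (emit root) <| .seq (passes Ts) cleanup

end CharForm

/-! ### Correctness and running time of the program -/

namespace CharForm

open Turing Function Prog

theorem unary_succ_append (m : ℕ) (l : List Unit) :
    unary (m + 1) ++ l = unary m ++ () :: l := by
  rw [unary, List.replicate_succ', List.append_assoc]
  rfl

theorem runs_move_store (c d : Ctr) (hcd : c ≠ d) (m : ℕ) (S : ∀ k, List (Alph k))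
    (h : S (.ctr c) = unary m) :
    Runs (move c d) S (2 * m + 1)
      (update (update S (.ctr c) []) (.ctr d) (unary m ++ S (.ctr d))) := by
  have hne : Stk.ctr d ≠ .ctr c := fun h => hcd (Stk.ctr.inj h).symm
  induction m generalizing S with
  | zero =>
    convert Runs.loop_nil h using 1
    rw [show ([] : List (Alph (.ctr c))) = S (.ctr c) from h.symm, update_eq_self]
    exact update_eq_self _ _
  | succ m ih =>
    have h' := Runs.loop_cons (Γ := Alph) (k := .ctr c) (x := ()) (l := unary m) (S := S)
      (isEnd := fun _ => false)
      (body := fun _ => .push (.ctr d) ()) h rfl rfl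
      (Runs.push (Γ := Alph) (.ctr d) () _)
      (ih _ (by rw [update_of_ne hne.symm, update_self]))
    convert h'.mono (T' := 2 * (m + 1) + 1) (by omega) using 1
    rw [update_self, update_of_ne hne, update_comm hne, update_idem, update_idem,
      unary_succ_append]

theorem runs_emitOnes_loop (c : Ctr) (hc : c ≠ .tmp) (m : ℕ) (S : ∀ k, List (Alph k))
    (h : S (.ctr c) = unary m) :
    Runs (.loop (.ctr c) (fun _ => false) fun _ => .seq (.push .rev .one) (.push (.ctr .tmp) ())) S
      (3 * m + 1)
      (update (update (update S (.ctr c) []) .rev (List.replicate m .one ++ S .rev))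
        (.ctr .tmp) (unary m ++ S (.ctr .tmp))) := by
  have hne : Stk.ctr .tmp ≠ .ctr c := fun h => hc (Stk.ctr.inj h).symm
  have h₁ : Stk.rev ≠ .ctr c := nofun
  have h₂ : Stk.rev ≠ .ctr .tmp := nofun
  induction m generalizing S with
  | zero =>
    convert Runs.loop_nil h using 1
    rw [show ([] : List (Alph (.ctr c))) = S (.ctr c) from h.symm, update_eq_self]
    exact (congrArg (fun f => update f _ _) (update_eq_self _ _)).trans (update_eq_self _ _)
  | succ m ih =>
    have h' := Runs.loop_cons (Γ := Alph) (k := .ctr c) (x := ()) (l := unary m) (S := S)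
      (isEnd := fun _ => false)
      (body := fun _ => .seq (.push .rev .one) (.push (.ctr .tmp) ())) h rfl rfl
      (Runs.seq (Runs.push (Γ := Alph) .rev .one _) (Runs.push (Γ := Alph) (.ctr .tmp) () _))
      (ih _ (by rw [update_of_ne hne.symm, update_of_ne h₁.symm, update_self]))
    convert h'.mono (T' := 3 * (m + 1) + 1) (by omega) using 1
    funext k
    by_cases hk : k = .ctr .tmp
    · subst hk
      simp only [update_self, ne_eq, hne, not_false_eq_true, update_of_ne, h₂.symm,
        unary_succ_append]
    by_cases hk' : k = .rev
    · subst hk'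
      simp only [update_self, ne_eq, not_false_eq_true, update_of_ne, h₂, h₁]
      rw [List.replicate_succ', List.append_assoc]
      rfl
    by_cases hk'' : k = .ctr c
    · subst hk''
      simp only [update_self, ne_eq, hk, not_false_eq_true, update_of_ne, hk']
    · simp only [ne_eq, hk, not_false_eq_true, update_of_ne, hk', hk'']

theorem runs_emitOnes (c : Ctr) (hc : c ≠ .tmp) (m : ℕ) (S : ∀ k, List (Alph k))
    (h : S (.ctr c) = unary m) (hS : S (.ctr .tmp) = []) :
    Runs (emitOnes c) S (5 * m + 2) (update S .rev (List.replicate m .one ++ S .rev)) := by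
  have hne : Stk.ctr .tmp ≠ .ctr c := fun h => hc (Stk.ctr.inj h).symm
  have h₁ : Stk.rev ≠ .ctr c := nofun
  have h₂ : Stk.rev ≠ .ctr .tmp := nofun
  have h' := Runs.seq (runs_emitOnes_loop c hc m S h)
    (runs_move_store .tmp c hc.symm m _ (by rw [update_self, hS]; exact List.append_nil _))
  unfold emitOnes
  convert h'.mono (T' := 5 * m + 2) (by omega) using 1
  funext k
  by_cases hk' : k = .rev
  · subst hk'
    simp only [update_self, ne_eq, not_false_eq_true, update_of_ne, h₂, h₁]
  by_cases hk'' : k = .ctr c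
  · subst hk''
    simp only [update_self, ne_eq, not_false_eq_true, update_of_ne, hk', hne.symm, h]
    exact (List.append_nil _).symm
  by_cases hk : k = .ctr .tmp
  · subst hk
    simp only [update_self, ne_eq, hne, not_false_eq_true, update_of_ne, hk', hS]
  · simp only [ne_eq, hk, not_false_eq_true, update_of_ne, hk', hk'']

theorem runs_push_tab (s : St) (b : Bool) :
    Runs (.push .tab b : Prog Alph) s.store 1 {s with tab := b :: s.tab}.store :=
  Runs.push_of_eq (s.update_tab _)

theorem runs_push_inp (s : St) (b : Bool) :
    Runs (.push .inp b : Prog Alph) s.store 1 {s with inp := b :: s.inp}.store :=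
  Runs.push_of_eq (s.update_inp _)

theorem runs_push_rev (s : St) (o : OutSym) :
    Runs (.push .rev o : Prog Alph) s.store 1 {s with rev := o :: s.rev}.store :=
  Runs.push_of_eq (s.update_rev _)

theorem runs_push_out (s : St) (o : OutSym) :
    Runs (.push .out o : Prog Alph) s.store 1 {s with out := o :: s.out}.store :=
  Runs.push_of_eq (s.update_out _)

theorem runs_push_actLeft (s : St) :
    Runs (.push (.ctr .actLeft) () : Prog Alph) s.store 1 {s with actLeft := s.actLeft + 1}.store :=
  Runs.push_of_eq (s.update_actLeft (s.actLeft + 1))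

theorem runs_push_actDone (s : St) :
    Runs (.push (.ctr .actDone) () : Prog Alph) s.store 1 {s with actDone := s.actDone + 1}.store :=
  Runs.push_of_eq (s.update_actDone (s.actDone + 1))

theorem runs_push_srcLeft (s : St) :
    Runs (.push (.ctr .srcLeft) () : Prog Alph) s.store 1 {s with srcLeft := s.srcLeft + 1}.store :=
  Runs.push_of_eq (s.update_srcLeft (s.srcLeft + 1))

theorem runs_push_srcDone (s : St) :
    Runs (.push (.ctr .srcDone) () : Prog Alph) s.store 1 {s with srcDone := s.srcDone + 1}.store :=
  Runs.push_of_eq (s.update_srcDone (s.srcDone + 1))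

theorem runs_push_tgtLeft (s : St) :
    Runs (.push (.ctr .tgtLeft) () : Prog Alph) s.store 1 {s with tgtLeft := s.tgtLeft + 1}.store :=
  Runs.push_of_eq (s.update_tgtLeft (s.tgtLeft + 1))

theorem runs_push_tgtDone (s : St) :
    Runs (.push (.ctr .tgtDone) () : Prog Alph) s.store 1 {s with tgtDone := s.tgtDone + 1}.store :=
  Runs.push_of_eq (s.update_tgtDone (s.tgtDone + 1))

theorem runs_push_size (s : St) :
    Runs (.push (.ctr .size) () : Prog Alph) s.store 1 {s with size := s.size + 1}.store :=
  Runs.push_of_eq (s.update_size (s.size + 1))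

theorem runs_push_proc (s : St) :
    Runs (.push (.ctr .proc) () : Prog Alph) s.store 1 {s with proc := s.proc + 1}.store :=
  Runs.push_of_eq (s.update_proc (s.proc + 1))

/-- The values that can be written. -/
def St.env (s : St) : Env := ⟨s.actDone, s.srcDone, s.tgtDone, s.size, s.proc⟩

/-- The time for writing a list of tokens, if the values are bounded by `B`. -/
def emitTime (B : ℕ) (l : List Tok) : ℕ := l.length * (5 * B + 2) + 1

theorem runs_emit (l : List Tok) (B : ℕ) (s : St) (hB : ∀ v, s.env.val v ≤ B) :
    Runs (emit l) s.store (emitTime B l)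
      {s with rev := (word s.env l).reverse ++ s.rev}.store := by
  induction l generalizing s with
  | nil => exact (Runs.skip _).mono (by simp [emitTime])
  | cons t l ih =>
    have ht : Runs (emitTok t) s.store (5 * B + 2)
        {s with rev := (t.word s.env).reverse ++ s.rev}.store := by
      cases t with
      | sym o =>
        exact (runs_push_rev s o).mono (by omega)
      | ones v =>
        have := runs_emitOnes v.ctr (by cases v <;> nofun) (s.env.val v) s.store
          (by cases v <;> rfl) rfl
        rw [St.update_rev] at this
        simp only [Tok.word, List.reverse_replicate]
        have h := hB v
        exact this.mono (by omega)
    have := Runs.seq ht (ih {s with rev := (t.word s.env).reverse ++ s.rev} hB)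
    simp only [word, List.flatMap_cons, List.reverse_append, List.append_assoc]
    exact this.mono (by simp only [emitTime, List.length_cons]; linarith)

theorem runs_setActFlag (s : St) :
    Runs (setFlag .actFlag) s.store 2 {s with actFlag := true}.store := by
  refine Runs.read (T := 1) (S₁ := {s with actFlag := false}.store) rfl ?_ ?_
  · rw [← s.update_actFlag false]
    congr 1
    show (flag s.actFlag).tail = []
    cases s.actFlag <;> rfl
  · exact Runs.push_of_eq (St.update_actFlag {s with actFlag := false} true)

theorem runs_setSrcFlag (s : St) :
    Runs (setFlag .srcFlag) s.store 2 {s with srcFlag := true}.store := by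
  refine Runs.read (T := 1) (S₁ := {s with srcFlag := false}.store) rfl ?_ ?_
  · rw [← s.update_srcFlag false]
    congr 1
    show (flag s.srcFlag).tail = []
    cases s.srcFlag <;> rfl
  · exact Runs.push_of_eq (St.update_srcFlag {s with srcFlag := false} true)

theorem runs_clear (k : Stk) (S : ∀ k, List (Alph k)) :
    Runs (clear k) S (2 * (S k).length + 1) (update S k []) := by
  generalize hl : S k = l
  induction l generalizing S with
  | nil =>
    rw [← hl, update_eq_self]
    exact (Runs.loop_nil hl).mono (by omega)
  | cons x l ih =>
    have := Runs.loop_cons (isEnd := fun _ => false) (body := fun _ => .skip) hl rfl rfl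
      (Runs.skip _)
      (ih (update S k l) (update_self ..))
    rw [update_idem] at this
    exact this.mono (by simp only [List.length_cons]; omega)

/-- An upper bound for the time that one visit of a template takes, apart from the loops. -/
def Template.cost (T : Template) (B : ℕ) : ℕ :=
  emitTime B T.start + emitTime B T.pre + emitTime B T.item + emitTime B (T.post false) +
    emitTime B (T.post true) + emitTime B (T.fin false) + emitTime B (T.fin true) + 10

theorem runs_itemBody (T : Template) (B : ℕ) (b : Bool) (s : St) (hB : ∀ v, s.env.val v ≤ B) :
    Runs (itemBody T (some b)) s.store (emitTime B T.item + 5)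
      {s with
        tab := b :: s.tab
        actFlag := s.actFlag || b
        srcFlag := s.srcFlag || b
        rev := (T.itemOut s.env s.tgtDone b).reverse ++ s.rev}.store := by
  cases b with
  | false =>
    simp only [Bool.or_false, Template.itemOut, Bool.false_eq_true, if_false, List.reverse_nil,
      List.nil_append]
    exact (runs_push_tab s false).mono (by omega)
  | true =>
    simp only [Bool.or_true, Template.itemOut, if_true]
    exact (Runs.seq (runs_push_tab s true) (Runs.seq
      (runs_emit T.item B {s with tab := true :: s.tab} hB)
      (Runs.seq (runs_setActFlag _) (runs_setSrcFlag _)))).mono (by omega)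

theorem runs_itemStep (T : Template) (B : ℕ) (b : Bool) (l : List Bool) (s : St)
    (hB : ∀ v, s.env.val v ≤ B) (hs : s.inp = b :: l) :
    Runs (itemStep T) s.store (emitTime B T.item + 7)
      {s with
        inp := l
        tab := b :: s.tab
        tgtDone := s.tgtDone + 1
        actFlag := s.actFlag || b
        srcFlag := s.srcFlag || b
        rev := (T.itemOut s.env s.tgtDone b).reverse ++ s.rev}.store := by
  have h₁ : (s.store .inp).head? = some b := by
    show s.inp.head? = _
    rw [hs]; rfl
  have h₂ : update s.store .inp (s.store .inp).tail = {s with inp := l}.store := by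
    rw [show (s.store .inp).tail = l by show s.inp.tail = l; rw [hs]; rfl]
    exact s.update_inp l
  have h := Runs.seq
    (Runs.read (body := itemBody T) h₁ h₂ (runs_itemBody T B b {s with inp := l} hB))
    (runs_push_tgtDone _)
  exact h.mono (by omega)

/-- The hypothesis on `s.tgtDone + bits.length` is what keeps the value `tgt` below `B` through all
iterations, so that the cost of one iteration is uniform. -/
theorem runs_itemLoop (T : Template) (B : ℕ) (rest bits : List Bool) (s : St)
    (hB : ∀ v, s.env.val v ≤ B) (hl : s.tgtDone + bits.length ≤ B)
    (hs : s.tgtLeft = bits.length) (hi : s.inp = bits ++ rest) :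
    Runs (itemLoop T) s.store (bits.length * T.cost B + 1)
      {s with
        tgtLeft := 0
        inp := rest
        tgtDone := s.tgtDone + bits.length
        tab := bits.reverse ++ s.tab
        actFlag := s.actFlag || bits.any id
        srcFlag := s.srcFlag || bits.any id
        rev := (idxFlat (T.itemOut s.env) s.tgtDone bits).reverse ++ s.rev}.store := by
  induction bits generalizing s with
  | nil =>
    cases s
    dsimp only [List.length_nil, List.nil_append] at hs hi
    subst hs hi
    simp only [List.length_nil, zero_mul, zero_add, add_zero, List.reverse_nil, List.nil_append,
      List.any_nil, Bool.or_false, idxFlat]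
    exact Runs.loop_nil rfl
  | cons b bits ih =>
    rw [List.length_cons] at hl hs
    have h₁ := runs_itemStep T B b (bits ++ rest) {s with tgtLeft := bits.length} hB hi
    have h₂ := Runs.loop_cons (Γ := Alph) (k := .ctr .tgtLeft) (x := ()) (l := unary bits.length)
      (S := s.store) (isEnd := fun _ => false) (body := fun _ => itemStep T)
      (by show unary s.tgtLeft = _; rw [hs]; rfl) rfl (s.update_tgtLeft _) h₁ (ih _ (by
        intro v
        cases v with
        | tgt => show s.tgtDone + 1 ≤ B; omega
        | act => exact hB .act
        | src => exact hB .src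
        | size => exact hB .size
        | proc => exact hB .proc) (by show s.tgtDone + 1 + bits.length ≤ B; omega) rfl rfl)
    convert h₂.mono (T' := (b :: bits).length * T.cost B + 1) ?_ using 2
    · simp only [St.mk.injEq, List.reverse_cons, List.append_assoc, List.singleton_append,
        List.length_cons, List.any_cons, id, Bool.or_assoc, idxFlat, List.reverse_append, true_and,
        and_true]
      -- The two environments differ in `tgt` only, which `itemOut` overrides.
      exact ⟨rfl, by omega⟩
    · simp only [List.length_cons, Template.cost, add_mul]
      omega

theorem runs_move_tgt (s : St) :
    Runs (move .tgtDone .tgtLeft) s.store (2 * s.tgtDone + 1)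
      {s with tgtDone := 0, tgtLeft := s.tgtDone + s.tgtLeft}.store := by
  have h := runs_move_store .tgtDone .tgtLeft nofun s.tgtDone s.store rfl
  -- The emptied stack `[]` has to be recognised as `unary 0`.
  erw [s.update_tgtDone 0] at h
  convert h using 1
  rw [← St.update_tgtLeft {s with tgtDone := 0} (s.tgtDone + s.tgtLeft)]
  congr 1
  exact List.replicate_add ..

theorem runs_move_act (s : St) :
    Runs (move .actDone .actLeft) s.store (2 * s.actDone + 1)
      {s with actDone := 0, actLeft := s.actDone + s.actLeft}.store := by
  have h := runs_move_store .actDone .actLeft nofun s.actDone s.store rfl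
  erw [s.update_actDone 0] at h
  convert h using 1
  rw [← St.update_actLeft {s with actDone := 0} (s.actDone + s.actLeft)]
  congr 1
  exact List.replicate_add ..

theorem runs_move_src (s : St) :
    Runs (move .srcDone .srcLeft) s.store (2 * s.srcDone + 1)
      {s with srcDone := 0, srcLeft := s.srcDone + s.srcLeft}.store := by
  have h := runs_move_store .srcDone .srcLeft nofun s.srcDone s.store rfl
  erw [s.update_srcDone 0] at h
  convert h using 1
  rw [← St.update_srcLeft {s with srcDone := 0} (s.srcDone + s.srcLeft)]
  congr 1
  exact List.replicate_add ..

theorem runs_read_actFlag (s : St) (f : Bool → List Tok) (B : ℕ) (hB : ∀ v, s.env.val v ≤ B) :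
    Runs (.read (.ctr .actFlag) fun o => emit (f o.isSome) : Prog Alph) s.store
      (emitTime B (f false) + emitTime B (f true) + 1)
      {s with
        actFlag := false
        rev := (word s.env (f s.actFlag)).reverse ++ s.rev}.store := by
  have h₁ : (s.store (.ctr .actFlag)).head? = if s.actFlag then some () else none := by
    show (flag s.actFlag).head? = _
    cases s.actFlag <;> rfl
  have h₂ : update s.store (.ctr .actFlag) (s.store (.ctr .actFlag)).tail =
      {s with actFlag := false}.store := by
    rw [← s.update_actFlag false]
    congr 1
    show (flag s.actFlag).tail = []
    cases s.actFlag <;> rfl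
  refine Runs.read (body := fun o : Option (Alph (.ctr .actFlag)) => emit (f o.isSome)) h₁ h₂ ?_
  have h := runs_emit (f s.actFlag) B {s with actFlag := false} hB
  have hi : (if s.actFlag then some () else none : Option Unit).isSome = s.actFlag := by
    cases s.actFlag <;> rfl
  rw [hi]
  refine h.mono ?_
  cases s.actFlag <;> omega

theorem runs_read_srcFlag (s : St) (f : Bool → List Tok) (B : ℕ) (hB : ∀ v, s.env.val v ≤ B) :
    Runs (.read (.ctr .srcFlag) fun o => emit (f o.isSome) : Prog Alph) s.store
      (emitTime B (f false) + emitTime B (f true) + 1)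
      {s with
        srcFlag := false
        rev := (word s.env (f s.srcFlag)).reverse ++ s.rev}.store := by
  have h₁ : (s.store (.ctr .srcFlag)).head? = if s.srcFlag then some () else none := by
    show (flag s.srcFlag).head? = _
    cases s.srcFlag <;> rfl
  have h₂ : update s.store (.ctr .srcFlag) (s.store (.ctr .srcFlag)).tail =
      {s with srcFlag := false}.store := by
    rw [← s.update_srcFlag false]
    congr 1
    show (flag s.srcFlag).tail = []
    cases s.srcFlag <;> rfl
  refine Runs.read (body := fun o : Option (Alph (.ctr .srcFlag)) => emit (f o.isSome)) h₁ h₂ ?_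
  have h := runs_emit (f s.srcFlag) B {s with srcFlag := false} hB
  have hi : (if s.srcFlag then some () else none : Option Unit).isSome = s.srcFlag := by
    cases s.srcFlag <;> rfl
  rw [hi]
  refine h.mono ?_
  cases s.srcFlag <;> omega

theorem runs_blockStep (T : Template) (B : ℕ) (rest bits : List Bool) (s : St)
    (hB : ∀ v, s.env.val v ≤ B) (hl : bits.length ≤ B) (hd : s.tgtDone = 0)
    (hs : s.tgtLeft = bits.length) (hi : s.inp = bits ++ rest) (hf : s.actFlag = false) :
    Runs (blockStep T) s.store ((B + 1) * (T.cost B + 2))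
      {s with
        inp := rest
        tab := bits.reverse ++ s.tab
        actDone := s.actDone + 1
        srcFlag := s.srcFlag || bits.any id
        rev := (T.blockOut s.env s.actDone bits).reverse ++ s.rev}.store := by
  obtain ⟨inp, tab, rev, out, aL, aD, sL, sD, tL, tD, size, proc, aF, sF⟩ := s
  dsimp only at hd hs hi hf
  subst hd hs hi hf
  have hB₁ : ∀ v, (⟨aD, sD, 0, size, proc⟩ : Env).val v ≤ B := hB
  have h₁ := runs_emit T.pre B _ hB
  have h₂ := runs_itemLoop T B rest bits ⟨bits ++ rest, tab,
    (word ⟨aD, sD, 0, size, proc⟩ T.pre).reverse ++ rev, out, aL, aD, sL, sD, bits.length, 0, size,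
    proc, false, sF⟩ hB₁ (by simpa using hl) rfl rfl
  have h₃ := h₁.seq (h₂.seq ((runs_move_tgt _).seq
    ((runs_read_actFlag _ T.post B (by exact hB₁)).seq (runs_push_actDone _))))
  unfold blockStep
  convert h₃.mono (T' := (B + 1) * (T.cost B + 2)) ?_ using 2
  · simp [Template.blockOut, St.env]
  · have := Nat.mul_le_mul_right (T.cost B) hl
    simp only [Template.cost, zero_add] at this ⊢
    nlinarith

theorem runs_blockLoop (T : Template) (B n : ℕ) (rest : List Bool) (row : List (List Bool)) (s : St)
    (hB : ∀ v, s.env.val v ≤ B) (hn : n ≤ B) (hd : s.tgtDone = 0) (ht : s.tgtLeft = n)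
    (hf : s.actFlag = false) (hl : s.actDone + row.length ≤ B) (hrow : ∀ bits ∈ row, bits.length = n)
    (hs : s.actLeft = row.length) (hi : s.inp = row.flatten ++ rest) :
    Runs (blockLoop T) s.store (row.length * ((B + 1) * (T.cost B + 2) + 1) + 1)
      {s with
        inp := rest
        tab := row.flatten.reverse ++ s.tab
        actLeft := 0
        actDone := s.actDone + row.length
        srcFlag := s.srcFlag || row.any fun bits => bits.any id
        rev := (idxFlat (T.blockOut s.env) s.actDone row).reverse ++ s.rev}.store := by
  induction row generalizing s with
  | nil =>
    cases s
    dsimp only [List.length_nil, List.nil_append, List.flatten_nil] at hs hi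
    subst hs hi
    simp only [List.length_nil, zero_mul, zero_add, add_zero, List.reverse_nil, List.nil_append,
      List.any_nil, Bool.or_false, idxFlat, List.flatten_nil]
    exact Runs.loop_nil rfl
  | cons bits row ih =>
    rw [List.length_cons] at hl hs
    have hbits := hrow bits List.mem_cons_self
    rw [List.flatten_cons, List.append_assoc] at hi
    have h₁ := runs_blockStep T B (row.flatten ++ rest) bits {s with actLeft := row.length} hB
      (by omega) hd (ht.trans hbits.symm) hi hf
    have h₂ := Runs.loop_cons (Γ := Alph) (k := .ctr .actLeft) (x := ()) (l := unary row.length)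
      (S := s.store) (isEnd := fun _ => false) (body := fun _ => blockStep T)
      (by show unary s.actLeft = _; rw [hs]; rfl) rfl (s.update_actLeft _) h₁ (ih _ (by
        intro v
        cases v with
        | act => show s.actDone + 1 ≤ B; omega
        | tgt => exact hB .tgt
        | src => exact hB .src
        | size => exact hB .size
        | proc => exact hB .proc) hd ht hf (by show s.actDone + 1 + row.length ≤ B; omega)
        (fun b hb => hrow b (List.mem_cons_of_mem _ hb)) rfl rfl)
    convert h₂.mono (T' := (bits :: row).length * ((B + 1) * (T.cost B + 2) + 1) + 1) ?_ using 2
    · simp only [St.mk.injEq, List.append_assoc, List.flatten_cons,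
        List.length_cons, List.any_cons, Bool.or_assoc, idxFlat, List.reverse_append, true_and,
        and_true]
      exact ⟨rfl, by omega⟩
    · simp only [List.length_cons, add_mul]
      omega

theorem runs_rowStep (T : Template) (B n : ℕ) (rest : List Bool) (row : List (List Bool)) (s : St)
    (hB : ∀ v, s.env.val v ≤ B) (hn : n ≤ B) (hd : s.tgtDone = 0) (ht : s.tgtLeft = n)
    (hf : s.actFlag = false) (hf' : s.srcFlag = false) (hl : row.length ≤ B) (ha : s.actDone = 0)
    (hrow : ∀ bits ∈ row, bits.length = n)
    (hs : s.actLeft = row.length) (hi : s.inp = row.flatten ++ rest) :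
    Runs (rowStep T) s.store ((B + 1) * ((B + 1) * (T.cost B + 2) + 3) + T.cost B)
      {s with
        inp := rest
        tab := row.flatten.reverse ++ s.tab
        srcDone := s.srcDone + 1
        rev := (T.rowOut s.env s.srcDone row).reverse ++ s.rev}.store := by
  obtain ⟨inp, tab, rev, out, aL, aD, sL, sD, tL, tD, size, proc, aF, sF⟩ := s
  dsimp only at hd ht hs hi hf hf' ha
  subst hd hs hi hf hf' ha ht
  have hB₁ : ∀ v, (⟨0, sD, 0, size, proc⟩ : Env).val v ≤ B := hB
  have h₁ := runs_emit T.start B _ hB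
  have h₂ := runs_blockLoop T B tL rest row ⟨row.flatten ++ rest, tab,
    (word ⟨0, sD, 0, size, proc⟩ T.start).reverse ++ rev, out,
    row.length, 0, sL, sD, tL, 0, size, proc, false, false⟩ hB₁ hn rfl rfl rfl (by simpa using hl)
    hrow rfl rfl
  have h₃ := h₁.seq (h₂.seq ((runs_move_act _).seq
    ((runs_read_srcFlag _ T.fin B (by exact hB₁)).seq (runs_push_srcDone _))))
  unfold rowStep
  convert h₃.mono (T' := (B + 1) * ((B + 1) * (T.cost B + 2) + 3) + T.cost B) ?_ using 2
  · simp [Template.rowOut, St.env]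
  · have := Nat.mul_le_mul_right ((B + 1) * (T.cost B + 2) + 1) hl
    simp only [Template.cost, zero_add] at this ⊢
    nlinarith

theorem runs_rowLoop (T : Template) (B n k : ℕ) (rest : List Bool) (table : List (List (List Bool)))
    (s : St)
    (hB : ∀ v, s.env.val v ≤ B) (hn : n ≤ B) (hk : k ≤ B) (hd : s.tgtDone = 0) (ht : s.tgtLeft = n)
    (hf : s.actFlag = false) (hf' : s.srcFlag = false) (ha : s.actDone = 0) (hal : s.actLeft = k)
    (hl : s.srcDone + table.length ≤ B)
    (htab : ∀ row ∈ table, row.length = k ∧ ∀ bits ∈ row, bits.length = n)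
    (hs : s.srcLeft = table.length) (hi : s.inp = table.flatten.flatten ++ rest) :
    Runs (rowLoop T) s.store
      (table.length * ((B + 1) * ((B + 1) * (T.cost B + 2) + 3) + T.cost B + 1) + 1)
      {s with
        inp := rest
        tab := table.flatten.flatten.reverse ++ s.tab
        srcLeft := 0
        srcDone := s.srcDone + table.length
        rev := (idxFlat (T.rowOut s.env) s.srcDone table).reverse ++ s.rev}.store := by
  induction table generalizing s with
  | nil =>
    cases s
    dsimp only [List.length_nil, List.nil_append, List.flatten_nil] at hs hi
    subst hs hi
    simp only [List.length_nil, zero_mul, zero_add, add_zero, List.reverse_nil, List.nil_append,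
      idxFlat, List.flatten_nil]
    exact Runs.loop_nil rfl
  | cons row table ih =>
    rw [List.length_cons] at hl hs
    obtain ⟨hrow, hbits⟩ := htab row List.mem_cons_self
    rw [List.flatten_cons, List.flatten_append, List.append_assoc] at hi
    have h₁ := runs_rowStep T B n (table.flatten.flatten ++ rest) row
      {s with srcLeft := table.length} hB hn hd ht hf hf' (by omega) ha hbits
      (hal.trans hrow.symm) hi
    have h₂ := Runs.loop_cons (Γ := Alph) (k := .ctr .srcLeft) (x := ()) (l := unary table.length)
      (S := s.store) (isEnd := fun _ => false) (body := fun _ => rowStep T)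
      (by show unary s.srcLeft = _; rw [hs]; rfl) rfl (s.update_srcLeft _) h₁ (ih _ (by
        intro v
        cases v with
        | src => show s.srcDone + 1 ≤ B; omega
        | tgt => exact hB .tgt
        | act => exact hB .act
        | size => exact hB .size
        | proc => exact hB .proc) hd ht hf hf' ha hal
        (by show s.srcDone + 1 + table.length ≤ B; omega)
        (fun b hb => htab b (List.mem_cons_of_mem _ hb)) rfl rfl)
    convert h₂.mono (T' := (row :: table).length *
      ((B + 1) * ((B + 1) * (T.cost B + 2) + 3) + T.cost B + 1) + 1) ?_ using 2
    · simp only [St.mk.injEq, List.append_assoc, List.flatten_cons,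
        List.flatten_append,
        List.length_cons, idxFlat, List.reverse_append, true_and, and_true]
      exact ⟨rfl, by omega⟩
    · simp only [List.length_cons, add_mul]
      omega

theorem runs_restore (l : List Bool) (s : St) (hs : s.tab = l) :
    Runs restore s.store (2 * l.length + 1)
      {s with tab := [], inp := l.reverse ++ s.inp}.store := by
  induction l generalizing s with
  | nil =>
    cases s
    dsimp only at hs
    subst hs
    exact Runs.loop_nil rfl
  | cons b l ih =>
    have h := Runs.loop_cons (Γ := Alph) (k := .tab) (x := b) (l := l) (S := s.store)
      (isEnd := fun _ => false) (body := fun b => .push .inp b) hs rfl (s.update_tab l)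
      (runs_push_inp {s with tab := l} b) (ih {s with tab := l, inp := b :: s.inp} rfl)
    convert h.mono (T' := 2 * (b :: l).length + 1) ?_ using 2
    · simp
    · simp only [List.length_cons]; omega

/-- The stacks between two passes. -/
def St.ready (k n p : ℕ) (bits : List Bool) (rev : List OutSym) : St where
  inp := bits
  rev := rev
  actLeft := k
  srcLeft := n
  tgtLeft := n
  size := n
  proc := p

def Template.passTime (T : Template) (B : ℕ) : ℕ :=
  B * ((B + 1) * ((B + 1) * (T.cost B + 2) + 3) + T.cost B + 1) + 4 * B + 3

/-- A pass leaves everything but `rev` as it found it, which is the invariant that lets passes be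
chained. -/
theorem runs_pass (T : Template) (B k p : ℕ) (table : List (List (List Bool))) (rev : List OutSym)
    (hn : table.length ≤ B) (hk : k ≤ B) (hp : p ≤ B) (hb : table.flatten.flatten.length ≤ B)
    (htab : ∀ row ∈ table, row.length = k ∧ ∀ bits ∈ row, bits.length = table.length) :
    Runs (pass T) (St.ready k table.length p table.flatten.flatten rev).store (T.passTime B)
      (St.ready k table.length p table.flatten.flatten
        ((T.tableOut ⟨0, 0, 0, table.length, p⟩ table).reverse ++ rev)).store := by
  have hB : ∀ v, (St.ready k table.length p table.flatten.flatten rev).env.val v ≤ B := by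
    intro v
    cases v with
    | size => exact hn
    | proc => exact hp
    | _ => exact Nat.zero_le _
  have h₁ := runs_rowLoop T B table.length k [] table
    (St.ready k table.length p table.flatten.flatten rev) hB hn hk rfl rfl rfl rfl rfl rfl
    (by simpa [St.ready] using hn) htab rfl (List.append_nil _).symm
  have h₂ := h₁.seq ((runs_move_src _).seq (runs_restore _ _ rfl))
  unfold pass
  convert h₂.mono (T' := T.passTime B) ?_ using 2
  · simp [St.ready, Template.tableOut, St.env]
  · have := Nat.mul_le_mul_right
      ((B + 1) * ((B + 1) * (T.cost B + 2) + 3) + T.cost B + 1) hn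
    simp only [St.ready, Template.passTime, List.append_nil, List.length_reverse, zero_add]
    omega

theorem runs_passes (Ts : List Template) (B k p : ℕ) (table : List (List (List Bool)))
    (rev : List OutSym)
    (hn : table.length ≤ B) (hk : k ≤ B) (hp : p ≤ B) (hb : table.flatten.flatten.length ≤ B)
    (htab : ∀ row ∈ table, row.length = k ∧ ∀ bits ∈ row, bits.length = table.length) :
    Runs (passes Ts) (St.ready k table.length p table.flatten.flatten rev).store
      ((Ts.map fun T => T.passTime B).sum + 1)
      (St.ready k table.length p table.flatten.flatten
        ((Ts.flatMap fun T => T.tableOut ⟨0, 0, 0, table.length, p⟩ table).reverse ++ rev)).store := by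
  induction Ts generalizing rev with
  | nil => exact Runs.skip _
  | cons T Ts ih =>
    have h := (runs_pass T B k p table rev hn hk hp hb htab).seq (ih _)
    simp only [List.flatMap_cons, List.reverse_append, List.append_assoc, List.map_cons,
      List.sum_cons, add_assoc] at h ⊢
    exact h

theorem runs_parse_act (m : ℕ) (rest : List Bool) (s : St)
    (hs : s.inp = List.replicate m true ++ false :: rest) :
    Runs (.loop .inp isFalse fun _ => .push (.ctr .actLeft) () : Prog Alph) s.store (2 * m + 1)
      {s with inp := rest, actLeft := s.actLeft + m}.store := by
  induction m generalizing s with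
  | zero => exact Runs.loop_end (x := false) (l := rest) hs rfl (s.update_inp rest)
  | succ m ih =>
    have h := Runs.loop_cons (Γ := Alph) (k := .inp) (x := true)
      (l := List.replicate m true ++ false :: rest) (S := s.store)
      (isEnd := isFalse) (body := fun _ => .push (.ctr .actLeft) ()) hs rfl (s.update_inp _)
      (runs_push_actLeft _) (ih _ rfl)
    convert h.mono (T' := 2 * (m + 1) + 1) (by omega) using 3
    exact (Nat.add_right_comm _ m 1)

theorem runs_parse_proc (m : ℕ) (rest : List Bool) (s : St)
    (hs : s.inp = List.replicate m true ++ false :: rest) :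
    Runs (.loop .inp isFalse fun _ => .push (.ctr .proc) () : Prog Alph) s.store (2 * m + 1)
      {s with inp := rest, proc := s.proc + m}.store := by
  induction m generalizing s with
  | zero => exact Runs.loop_end (x := false) (l := rest) hs rfl (s.update_inp rest)
  | succ m ih =>
    have h := Runs.loop_cons (Γ := Alph) (k := .inp) (x := true)
      (l := List.replicate m true ++ false :: rest) (S := s.store)
      (isEnd := isFalse) (body := fun _ => .push (.ctr .proc) ()) hs rfl (s.update_inp _)
      (runs_push_proc _) (ih _ rfl)
    convert h.mono (T' := 2 * (m + 1) + 1) (by omega) using 3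
    exact (Nat.add_right_comm _ m 1)

theorem runs_parse_size (m : ℕ) (rest : List Bool) (s : St)
    (hs : s.inp = List.replicate m true ++ false :: rest) :
    Runs (.loop .inp isFalse fun _ => .seq (.push (.ctr .size) ())
      (.seq (.push (.ctr .srcLeft) ()) (.push (.ctr .tgtLeft) ())) : Prog Alph) s.store (4 * m + 1)
      {s with inp := rest, size := s.size + m, srcLeft := s.srcLeft + m,
              tgtLeft := s.tgtLeft + m}.store := by
  induction m generalizing s with
  | zero => exact Runs.loop_end (x := false) (l := rest) hs rfl (s.update_inp rest)
  | succ m ih =>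
    have h := Runs.loop_cons (Γ := Alph) (k := .inp) (x := true)
      (l := List.replicate m true ++ false :: rest) (S := s.store)
      (isEnd := isFalse) (body := fun _ => .seq (.push (.ctr .size) ())
      (.seq (.push (.ctr .srcLeft) ()) (.push (.ctr .tgtLeft) ()))) hs rfl (s.update_inp _)
      ((runs_push_size _).seq ((runs_push_srcLeft _).seq (runs_push_tgtLeft _))) (ih _ rfl)
    convert h.mono (T' := 4 * (m + 1) + 1) (by omega) using 3
    all_goals exact (Nat.add_right_comm _ m 1)

theorem Input.encode_eq (p : Input) : p.encode =
    List.replicate p.k true ++ false :: (List.replicate p.lts.n true ++ false ::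
      (List.replicate (p.proc : ℕ) true ++ false :: p.table.flatten.flatten)) := by
  simp [Input.encode, Input.table, List.flatMap_def, List.flatten_flatten, Function.comp_def]

theorem runs_parse (p : Input) :
    Runs parse ({inp := p.encode} : St).store (2 * p.k + 4 * p.lts.n + 2 * p.proc + 3)
      (St.ready p.k p.lts.n p.proc p.table.flatten.flatten []).store := by
  have h := (runs_parse_act p.k _ ({inp := p.encode} : St) p.encode_eq).seq
    ((runs_parse_size p.lts.n _ _ rfl).seq (runs_parse_proc p.proc _ _ rfl))
  unfold parse
  convert h.mono (T' := 2 * p.k + 4 * p.lts.n + 2 * p.proc + 3) (by omega) using 2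
  simp [St.ready]

theorem runs_reverse (l : List OutSym) (s : St) (hs : s.rev = l) :
    Runs (.loop .rev (fun _ => false) fun o => .push .out o : Prog Alph) s.store (2 * l.length + 1)
      {s with rev := [], out := l.reverse ++ s.out}.store := by
  induction l generalizing s with
  | nil =>
    cases s
    dsimp only at hs
    subst hs
    exact Runs.loop_nil rfl
  | cons b l ih =>
    have h := Runs.loop_cons (Γ := Alph) (k := .rev) (x := b) (l := l) (S := s.store)
      (isEnd := fun _ => false) (body := fun b => .push .out b) hs rfl (s.update_rev l)
      (runs_push_out {s with rev := l} b) (ih {s with rev := l, out := b :: s.out} rfl)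
    convert h.mono (T' := 2 * (b :: l).length + 1) ?_ using 2
    · simp
    · simp only [List.length_cons]; omega

theorem runs_cleanup (k n p : ℕ) (bits : List Bool) (rev : List OutSym) :
    Runs cleanup (St.ready k n p bits rev).store
      (2 * bits.length + 2 * k + 6 * n + 2 * p + 2 * rev.length + 7)
      ({inp := [], out := rev.reverse} : St).store := by
  have h₁ := runs_clear .inp (St.ready k n p bits rev).store
  rw [St.update_inp] at h₁
  have h₂ := runs_clear (.ctr .actLeft) {St.ready k n p bits rev with inp := []}.store
  erw [St.update_actLeft _ 0] at h₂
  have h₃ := runs_clear (.ctr .srcLeft) {St.ready k n p bits rev with inp := [], actLeft := 0}.store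
  erw [St.update_srcLeft _ 0] at h₃
  have h₄ := runs_clear (.ctr .tgtLeft)
    {St.ready k n p bits rev with inp := [], actLeft := 0, srcLeft := 0}.store
  erw [St.update_tgtLeft _ 0] at h₄
  have h₅ := runs_clear (.ctr .size)
    {St.ready k n p bits rev with inp := [], actLeft := 0, srcLeft := 0, tgtLeft := 0}.store
  erw [St.update_size _ 0] at h₅
  have h₆ := runs_clear (.ctr .proc)
    {St.ready k n p bits rev with inp := [], actLeft := 0, srcLeft := 0, tgtLeft := 0,
                                  size := 0}.store
  erw [St.update_proc _ 0] at h₆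
  have h₇ := runs_reverse rev
    {St.ready k n p bits rev with inp := [], actLeft := 0, srcLeft := 0, tgtLeft := 0,
                                  size := 0, proc := 0} rfl
  have h := h₁.seq (h₂.seq (h₃.seq (h₄.seq (h₅.seq (h₆.seq h₇)))))
  unfold cleanup
  convert h.mono (T' := 2 * bits.length + 2 * k + 6 * n + 2 * p + 2 * rev.length + 7) ?_ using 2
  · simp [St.ready]
  · simp only [St.ready, St.store, List.length_replicate]
    omega

/-- The time before the final cleanup. -/
def writeTime (root : List Tok) (Ts : List Template) (B : ℕ) : ℕ :=
  8 * B + 3 + emitTime B root + ((Ts.map fun T => T.passTime B).sum + 1)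

/-- The length of the input bounds all counters and the table, so it serves as `B` throughout. The
factor 3 is one `writeTime` for writing and two for reversing an output that is no longer than
`writeTime`. -/
theorem runs_mainProg (root : List Tok) (Ts : List Template) (p : Input) :
    Runs (mainProg root Ts) ({inp := p.encode} : St).store
      (3 * writeTime root Ts p.encode.length + 12 * p.encode.length + 7)
      ({inp := [], out := templateOut root Ts p} : St).store := by
  set B := p.encode.length with hBdef
  have hlen := congrArg List.length p.encode_eq
  simp only [List.length_append, List.length_replicate, List.length_cons, ← hBdef] at hlen
  have htl : p.table.length = p.lts.n := by simp [Input.table]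
  have htab : ∀ row ∈ p.table, row.length = p.k ∧ ∀ bits ∈ row, bits.length = p.table.length := by
    rw [htl]
    simp only [Input.table, List.mem_map]
    rintro _ ⟨s, -, rfl⟩
    simp only [List.length_map, List.length_finRange, List.mem_map, true_and]
    rintro _ ⟨a, -, rfl⟩
    simp
  have hB : ∀ v, (St.ready p.k p.lts.n p.proc p.table.flatten.flatten []).env.val v ≤ B := by
    intro v
    cases v with
    | size => show p.lts.n ≤ B; omega
    | proc => show (p.proc : ℕ) ≤ B; omega
    | _ => exact Nat.zero_le _
  have h₂ := runs_passes Ts B p.k p.proc p.table (word ⟨0, 0, 0, p.lts.n, p.proc⟩ root).reverse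
    (by omega) (by omega) (by omega) (by omega) htab
  rw [htl] at h₂
  have h₁ := runs_emit root B _ hB
  simp only [St.ready, List.append_nil] at h₁ h₂
  have h := (runs_parse p).seq (h₁.seq h₂)
  rw [← List.reverse_append] at h
  change Runs _ _ _ (St.ready p.k p.lts.n p.proc p.table.flatten.flatten
    (templateOut root Ts p).reverse).store at h
  -- The output is no longer than the time in which it was pushed.
  have hT : (templateOut root Ts p).length ≤ writeTime root Ts B := by
    obtain ⟨t, ht, he⟩ := h
    have := he.length_le .rev
    simp only [St.ready, St.store, List.length_reverse, List.length_nil, zero_add] at this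
    simp only [writeTime]
    omega
  have hc := runs_cleanup p.k p.lts.n p.proc p.table.flatten.flatten (templateOut root Ts p).reverse
  rw [List.reverse_reverse] at hc
  obtain ⟨t, ht, he⟩ := h
  obtain ⟨t', ht', he'⟩ := hc
  rw [List.length_reverse] at ht'
  -- The run is taken apart because `cleanup` sits innermost in `mainProg`, while `he` is a run of
  -- the part before it.
  cases he with
  | seq e₁ e₂ =>
    cases e₂ with
    | seq e₂ e₃ =>
      refine ⟨_, ?_, .seq e₁ (.seq e₂ (.seq e₃ he'))⟩
      simp only [writeTime] at ht hT ⊢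
      omega

/-! ### Polynomial bounds and the Turing machine -/

/-- The function is given by a polynomial. -/
def IsPoly (f : ℕ → ℕ) : Prop := ∃ P : Polynomial ℕ, ∀ B, P.eval B = f B

theorem IsPoly.const (c : ℕ) : IsPoly fun _ => c := ⟨.C c, fun _ => Polynomial.eval_C⟩

theorem IsPoly.id : IsPoly fun B => B := ⟨.X, fun _ => Polynomial.eval_X⟩

theorem IsPoly.add {f g : ℕ → ℕ} (hf : IsPoly f) (hg : IsPoly g) : IsPoly fun B => f B + g B :=
  let ⟨P, hP⟩ := hf
  let ⟨Q, hQ⟩ := hg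
  ⟨P + Q, fun B => by rw [Polynomial.eval_add, hP, hQ]⟩

theorem IsPoly.mul {f g : ℕ → ℕ} (hf : IsPoly f) (hg : IsPoly g) : IsPoly fun B => f B * g B :=
  let ⟨P, hP⟩ := hf
  let ⟨Q, hQ⟩ := hg
  ⟨P * Q, fun B => by rw [Polynomial.eval_mul, hP, hQ]⟩

theorem isPoly_emitTime (l : List Tok) : IsPoly fun B => emitTime B l :=
  ((IsPoly.const _).mul (((IsPoly.const _).mul .id).add (.const _))).add (.const _)

theorem Template.isPoly_cost (T : Template) : IsPoly T.cost :=
  (((((((isPoly_emitTime _).add (isPoly_emitTime _)).add (isPoly_emitTime _)).add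
    (isPoly_emitTime _)).add (isPoly_emitTime _)).add (isPoly_emitTime _)).add
    (isPoly_emitTime _)).add (.const _)

theorem Template.isPoly_passTime (T : Template) : IsPoly T.passTime := by
  have h₁ : IsPoly fun B => B + 1 := IsPoly.id.add (.const _)
  exact ((IsPoly.id.mul (((h₁.mul ((h₁.mul (T.isPoly_cost.add (.const _))).add (.const _))).add
    T.isPoly_cost).add (.const _))).add ((IsPoly.const _).mul .id)).add (.const _)

theorem isPoly_sum_passTime (Ts : List Template) :
    IsPoly fun B => (Ts.map fun T => T.passTime B).sum := by
  induction Ts with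
  | nil => exact .const 0
  | cons T Ts ih => exact T.isPoly_passTime.add ih

theorem isPoly_writeTime (root : List Tok) (Ts : List Template) : IsPoly (writeTime root Ts) :=
  ((((IsPoly.const _).mul .id).add (.const _)).add (isPoly_emitTime root)).add
    ((isPoly_sum_passTime Ts).add (.const _))

theorem initList_machine (p : Prog Alph) (l : List Bool) :
    initList (p.machine .inp .out) l = ⟨some (some p.entry), none, ({inp := l} : St).store⟩ := by
  refine congrArg (TM2.Cfg.mk _ _) (funext fun k => ?_)
  rcases k with _ | _ | _ | _ | c <;> [skip; skip; skip; skip; cases c] <;> rfl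

theorem haltList_machine (p : Prog Alph) (l : List OutSym) :
    haltList (p.machine .inp .out) l = ⟨none, none, ({inp := [], out := l} : St).store⟩ := by
  refine congrArg (TM2.Cfg.mk _ _) (funext fun k => ?_)
  rcases k with _ | _ | _ | _ | c <;> [skip; skip; skip; skip; cases c] <;> rfl

/-- A system of equations that is described by templates can be written in polynomial time. -/
theorem templateOut_polyTime (root : List Tok) (Ts : List Template) :
    Nonempty (TM2ComputableInPolyTime Input.encode id (templateOut root Ts)) := by
  obtain ⟨P, hP⟩ : IsPoly fun B => 3 * writeTime root Ts B + 12 * B + 7 + 1 :=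
    ((((IsPoly.const _).mul (isPoly_writeTime root Ts)).add ((IsPoly.const _).mul .id)).add
      (.const _)).add (.const _)
  refine ⟨{
    tm := (mainProg root Ts).machine .inp .out
    inputAlphabet := Equiv.refl Bool
    outputAlphabet := Equiv.refl OutSym
    time := P
    outputsFun := fun p => Classical.choice ?_ }⟩
  obtain ⟨t, ht, he⟩ := runs_mainProg root Ts p
  have h := he.machine_evals (k₀ := .inp) (k₁ := .out)
  refine ⟨⟨⟨t + 1, ?_⟩, by rw [hP]; exact Nat.succ_le_succ ht⟩⟩
  have hi := (congrArg (initList _) (List.map_id p.encode)).trans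
    (initList_machine (mainProg root Ts) p.encode)
  have ho := (congrArg (haltList _) (List.map_id (templateOut root Ts p))).trans
    (haltList_machine (mainProg root Ts) (templateOut root Ts p))
  exact (congrArg _ (congrArg some hi)).trans (h.trans (congrArg some ho.symm))

end CharForm

/-! ## Characteristic formulae -/

namespace CharForm

/-! ### Formulae that are built along a list -/

section Foldr

variable {k : ℕ} {V : Type} {ι : Type}

theorem subst_foldr {W : Type} (σ : V → Form k W) (g : ι → Form k V → Form k V)
    (g' : ι → Form k W → Form k W) (h : ∀ a ψ, (g a ψ).subst σ = g' a (ψ.subst σ)) (l : List ι)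
    (φ : Form k V) : (l.foldr g φ).subst σ = l.foldr g' (φ.subst σ) := by
  induction l with
  | nil => rfl
  | cons a l ih => rw [List.foldr_cons, h, ih, List.foldr_cons]

theorem occurs_foldr (v : V) (g : ι → Form k V → Form k V) (P : ι → Prop)
    (h : ∀ a ψ, (g a ψ).Occurs v → P a ∨ ψ.Occurs v) (l : List ι) (φ : Form k V)
    (ho : (l.foldr g φ).Occurs v) : (∃ a, P a) ∨ φ.Occurs v := by
  induction l with
  | nil => exact .inr ho
  | cons a l ih => exact (h a _ ho).elim (fun h => .inl ⟨a, h⟩) ih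

/-- In prefix notation a step of the fold only puts a word in front, so the encoding of the fold can
be written from left to right without closing anything. This is why the output can be produced in
one pass. -/
theorem encode_foldr {m : ℕ} (g : ι → Form k (Fin m) → Form k (Fin m)) (pre : ι → List OutSym)
    (h : ∀ a ψ, (g a ψ).encode = pre a ++ ψ.encode) (l : List ι) (φ : Form k (Fin m)) :
    (l.foldr g φ).encode = l.flatMap pre ++ φ.encode := by
  induction l with
  | nil => rfl
  | cons a l ih => rw [List.foldr_cons, h, ih, List.flatMap_cons, List.append_assoc]

theorem mem_foldr (L : HML k → Prop) (g : ι → HML k → HML k) (l : List ι)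
    (h : ∀ a ψ, L ψ → L (g a ψ)) (φ : HML k) (hφ : L φ) : L (l.foldr g φ) := by
  induction l with
  | nil => exact hφ
  | cons a l ih => exact h a _ ih

theorem sat_foldr_and (T : LTS k) (q : Fin T.n) (g : ι → HML k → HML k) (P : ι → Prop)
    (h : ∀ a ψ, Sat T q (g a ψ) ↔ P a ∧ Sat T q ψ) (l : List ι) (φ : HML k) :
    Sat T q (l.foldr g φ) ↔ (∀ a ∈ l, P a) ∧ Sat T q φ := by
  induction l with
  | nil => simp
  | cons a l ih => rw [List.foldr_cons, h, ih, List.forall_mem_cons, and_assoc]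

theorem sat_foldr_or (T : LTS k) (q : Fin T.n) (g : ι → HML k → HML k) (P : ι → Prop)
    (h : ∀ a ψ, Sat T q (g a ψ) ↔ P a ∨ Sat T q ψ) (l : List ι) (φ : HML k) :
    Sat T q (l.foldr g φ) ↔ (∃ a ∈ l, P a) ∨ Sat T q φ := by
  induction l with
  | nil => simp
  | cons a l ih => rw [List.foldr_cons, h, ih, List.exists_mem_cons_iff, or_assoc]

end Foldr

/-! ### The right-hand sides -/

section Rows

variable {k : ℕ} (S : PreLTS k) (s : Fin S.n) {V : Type}

/-- The action `a` is enabled in the state `s`. -/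
def PreLTS.enabled (a : Fin k) : Bool := (List.finRange S.n).any fun r => S.trans s a r

/-- The state `s` has a transition. -/
def PreLTS.live : Bool := (List.finRange k).any fun a => S.enabled s a

variable {S s} in
theorem PreLTS.enabled_eq_true {a : Fin k} : S.enabled s a = true ↔ ∃ r, S.trans s a r = true := by
  simp [PreLTS.enabled]

/-- The conjunction of the `⟨a⟩X_r` over all transitions from `s` to `r` with `a`, of `φ`, and, if
`ready` is set, of `[a]ff` for all actions `a` that are not enabled in `s`. -/
def diaRow (ready : Bool) (X : Fin S.n → Form k V) (φ : Form k V) : Form k V :=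
  (List.finRange k).foldr (fun a ψ => (List.finRange S.n).foldr
    (fun r ψ => if S.trans s a r then .and (.dia a (X r)) ψ else ψ)
    -- This conjunct follows the transitions with `a`, because only after reading them does a
    -- left-to-right pass know whether `a` is enabled.
    (if ready && !S.enabled s a then .and (.box a .ff) ψ else ψ)) φ

/-- The disjunction of `φ` and, over all actions `a`, of `⟨a⟩` applied to the conjunction of the
`X_r` over all transitions from `s` to `r` with `a`. -/
def muRow (X : Fin S.n → Form k V) (φ : Form k V) : Form k V :=
  (List.finRange k).foldr (fun a ψ => .or (.dia a ((List.finRange S.n).foldr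
    (fun r ψ => if S.trans s a r then .and (X r) ψ else ψ) .tt)) ψ) φ

/-- The formula `𝟎`. -/
def zeroRow (k : ℕ) (V : Type) : Form k V :=
  (List.finRange k).foldr (fun a φ => .and (.box a .ff) φ) .tt

theorem subst_diaRow {W : Type} (σ : V → Form k W) (ready : Bool) (X : Fin S.n → Form k V)
    (φ : Form k V) : (diaRow S s ready X φ).subst σ =
      diaRow S s ready (fun r => (X r).subst σ) (φ.subst σ) := by
  refine subst_foldr σ _ _ (fun a ψ => ?_) _ _
  rw [subst_foldr σ _ (fun r ψ => if S.trans s a r then .and (.dia a ((X r).subst σ)) ψ else ψ)]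
  · split_ifs <;> rfl
  · intro r ψ; split_ifs <;> rfl

theorem subst_muRow {W : Type} (σ : V → Form k W) (X : Fin S.n → Form k V) (φ : Form k V) :
    (muRow S s X φ).subst σ = muRow S s (fun r => (X r).subst σ) (φ.subst σ) := by
  refine subst_foldr σ _ _ (fun a ψ => ?_) _ _
  rw [Form.subst, Form.subst,
    subst_foldr σ _ (fun r ψ => if S.trans s a r then .and ((X r).subst σ) ψ else ψ)]
  · rfl
  · intro r ψ; split_ifs <;> rfl

theorem subst_zeroRow {W : Type} (σ : V → Form k W) : (zeroRow k V).subst σ = zeroRow k W :=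
  subst_foldr σ _ _ (fun _ _ => rfl) _ _

variable {S s} in
theorem occurs_diaRow {v : V} {ready : Bool} {X : Fin S.n → Form k V} {φ : Form k V}
    (h : (diaRow S s ready X φ).Occurs v) :
    (∃ a r, S.trans s a r = true ∧ (X r).Occurs v) ∨ φ.Occurs v := by
  refine occurs_foldr v _ _ (fun a ψ ho => ?_) _ _ h
  have hr : ∀ (r : Fin S.n) (ψ : Form k V),
      (if S.trans s a r then .and (.dia a (X r)) ψ else ψ).Occurs v →
      (S.trans s a r = true ∧ (X r).Occurs v) ∨ ψ.Occurs v := by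
    intro r ψ ho
    split_ifs at ho with ht
    · exact ho.imp (fun h => ⟨ht, h⟩) id
    · exact .inr ho
  rcases occurs_foldr v _ _ hr _ _ ho with h | h
  · exact .inl h
  · split_ifs at h
    · exact .inr (h.elim False.elim id)
    · exact .inr h

variable {S s} in
theorem occurs_muRow {v : V} {X : Fin S.n → Form k V} {φ : Form k V}
    (h : (muRow S s X φ).Occurs v) :
    (∃ a r, S.trans s a r = true ∧ (X r).Occurs v) ∨ φ.Occurs v := by
  refine occurs_foldr v _ _ (fun a ψ ho => ?_) _ _ h
  have hr : ∀ (r : Fin S.n) (ψ : Form k V),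
      (if S.trans s a r then .and (X r) ψ else ψ).Occurs v →
      (S.trans s a r = true ∧ (X r).Occurs v) ∨ ψ.Occurs v := by
    intro r ψ ho
    split_ifs at ho with ht
    · exact ho.imp (fun h => ⟨ht, h⟩) id
    · exact .inr ho
  exact ho.imp (fun ho => (occurs_foldr v _ _ hr _ _ ho).elim id False.elim) id

theorem not_occurs_zeroRow {v : V} : ¬ (zeroRow k V).Occurs v := fun h => by
  rcases occurs_foldr v (fun a φ => .and (.box a .ff) φ) (fun _ => False)
    (fun a ψ ho => ho) _ _ h with ⟨_, h⟩ | h <;> exact h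

theorem diaRow_mem {L : HML k → Prop} (hand : ∀ {φ ψ}, L φ → L ψ → L (.and φ ψ))
    (hdia : ∀ {φ} a, L φ → L (.dia a φ)) {ready : Bool} (hbox : ready = true → ∀ a, L (.box a .ff))
    {X : Fin S.n → HML k} {φ : HML k} (hX : ∀ a r, S.trans s a r = true → L (X r)) (hφ : L φ) :
    L (diaRow S s ready X φ) := by
  refine mem_foldr L _ _ (fun a ψ hψ => mem_foldr L _ _ (fun r ψ hψ => ?_) _ ?_) _ hφ
  · split_ifs with h
    · exact hand (hdia a (hX a r h)) hψ
    · exact hψ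
  · split_ifs with h
    · exact hand (hbox (by simp at h; exact h.1) a) hψ
    · exact hψ

theorem muRow_mem {L : HML k → Prop} (htt : L .tt) (hand : ∀ {φ ψ}, L φ → L ψ → L (.and φ ψ))
    (hor : ∀ {φ ψ}, L φ → L ψ → L (.or φ ψ)) (hdia : ∀ {φ} a, L φ → L (.dia a φ))
    {X : Fin S.n → HML k} {φ : HML k} (hX : ∀ a r, S.trans s a r = true → L (X r)) (hφ : L φ) :
    L (muRow S s X φ) := by
  refine mem_foldr L _ _ (fun a ψ hψ => hor (hdia a (mem_foldr L _ _ (fun r ψ hψ => ?_) _ htt)) hψ)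
    _ hφ
  split_ifs with h
  · exact hand (hX a r h) hψ
  · exact hψ

/-- The first clause is the simulation condition from `s` to `q`; the second, under `ready`, says
that `q` enables no action that `s` does not. -/
theorem sat_diaRow {T : LTS k} {q : Fin T.n} {ready : Bool} {X : Fin S.n → HML k} {φ : HML k} :
    Sat T q (diaRow S s ready X φ) ↔
      (∀ a, (∀ r, S.trans s a r = true → ∃ q', T.trans q a q' = true ∧ Sat T q' (X r)) ∧
        (ready = true → S.enabled s a = false → T.enabled q a = false)) ∧ Sat T q φ := by
  rw [diaRow, sat_foldr_and T q _
    (fun a => (∀ r, S.trans s a r = true → ∃ q', T.trans q a q' = true ∧ Sat T q' (X r)) ∧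
        (ready = true → S.enabled s a = false → T.enabled q a = false))]
  · simp
  · intro a ψ
    rw [sat_foldr_and T q _
      (fun r => S.trans s a r = true → ∃ q', T.trans q a q' = true ∧ Sat T q' (X r))]
    · rw [and_assoc]
      refine and_congr (by simp) ?_
      cases ready <;> cases S.enabled s a <;> simp [Sat, PreLTS.enabled]
    · intro r ψ
      split_ifs with h <;> simp [Sat, h]

/-- Read negatively: if the row fails at `q`, then every move of `q` has a counterpart `r` whose
formula `X r` fails as well. This is how simulation in the reverse direction is obtained. -/
theorem sat_muRow {T : LTS k} {q : Fin T.n} {X : Fin S.n → HML k} {φ : HML k} :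
    Sat T q (muRow S s X φ) ↔
      (∃ a q', T.trans q a q' = true ∧ ∀ r, S.trans s a r = true → Sat T q' (X r)) ∨
        Sat T q φ := by
  rw [muRow, sat_foldr_or T q _
    (fun a => ∃ q', T.trans q a q' = true ∧ ∀ r, S.trans s a r = true → Sat T q' (X r))]
  · simp
  · intro a ψ
    refine or_congr (exists_congr fun q' => and_congr Iff.rfl ?_) Iff.rfl
    rw [sat_foldr_and T q' _ (fun r => S.trans s a r = true → Sat T q' (X r))]
    · simp [Sat]
    · intro r ψ
      split_ifs with h <;> simp [Sat, h]

theorem sat_zeroForm {T : LTS k} {q : Fin T.n} : Sat T q (zeroForm k) ↔ T.live q = false := by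
  rw [zeroForm, sat_foldr_and T q _ (fun a => ∀ r, T.trans q a r = false)]
  · simp [Sat, PreLTS.live, PreLTS.enabled]
  · intro a ψ
    simp [Sat]

end Rows

/-! ### Templates for the right-hand sides -/

/-- The index of the variable that belongs to a family and a state. -/
def idx {J n : ℕ} (j : Fin J) (s : Fin n) : Fin (J * n) := finProdFinEquiv (j, s)

theorem val_idx {J n : ℕ} (j : Fin J) (s : Fin n) : (idx j s : ℕ) = j * n + s := by
  simp [idx, mul_comm, add_comm]

def actTok : List Tok := [.ones .act, .sym .endnum]

/-- The variable that belongs to the family `j` and the state `v`. -/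
def varTok (j : ℕ) (v : Val) : List Tok :=
  .sym .var :: (List.replicate j (.ones .size) ++ [.ones v, .sym .endnum])

theorem word_append (e : Env) (l l' : List Tok) : word e (l ++ l') = word e l ++ word e l' :=
  List.flatMap_append

theorem word_cons_sym (e : Env) (o : OutSym) (l : List Tok) :
    word e (.sym o :: l) = o :: word e l := rfl

theorem word_nil (e : Env) : word e [] = [] := rfl

theorem word_actTok (e : Env) : word e actTok = encodeNum e.act := rfl

/-- The family index `j` is fixed with the template, so the product `j * e.size` is written as `j`
copies of a block, and no arithmetic is done by the machine. -/
theorem word_indexTok (e : Env) (j : ℕ) (v : Val) :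
    word e (List.replicate j (.ones .size) ++ [.ones v, .sym .endnum]) =
      encodeNum (j * e.size + e.val v) := by
  induction j with
  | zero => simp [word, Tok.word, encodeNum]
  | succ j ih =>
    rw [List.replicate_succ, List.cons_append, word, List.flatMap_cons, ← word, ih]
    simp only [Tok.word, Env.val, encodeNum, ← List.append_assoc, List.replicate_append_replicate]
    congr 2
    ring

theorem word_varTok (e : Env) (j : ℕ) (v : Val) :
    word e (varTok j v) = .var :: encodeNum (j * e.size + e.val v) :=
  congrArg _ (word_indexTok e j v)

/-- The template for `diaRow`. -/
def diaTemplate (ready : Bool) (j : ℕ) (fin : Bool → List Tok) : Template where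
  start := [.sym .eqn]
  pre := []
  item := .sym .and :: .sym .dia :: (actTok ++ varTok j .tgt)
  post b := if ready && !b then .sym .and :: .sym .box :: (actTok ++ [.sym .ff]) else []
  fin := fin

/-- The template for `muRow`. -/
def muTemplate (neg : Bool) (j : ℕ) (fin : Bool → List Tok) : Template where
  start := [.sym .eqn]
  pre := .sym .or :: .sym .dia :: actTok
  item := .sym .and :: ((if neg then [.sym .neg] else []) ++ varTok j .tgt)
  post _ := [.sym .tt]
  fin := fin

/-- The template for `zeroRow`. -/
def zeroTemplate : Template where
  start := [.sym .eqn]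
  pre := .sym .and :: .sym .box :: (actTok ++ [.sym .ff])
  item := []
  post _ := []
  fin _ := [.sym .tt]

/-- The row of a state in the transition table. -/
def PreLTS.row {k : ℕ} (S : PreLTS k) (s : Fin S.n) : List (List Bool) :=
  (List.finRange k).map fun a => (List.finRange S.n).map fun r => S.trans s a r

section RowOut

variable {k J : ℕ} (S : PreLTS k) (s : Fin S.n) (p : ℕ)

theorem rowOut_row (T : Template) : T.rowOut ⟨0, 0, 0, S.n, p⟩ s (S.row s) =
    word ⟨0, s, 0, S.n, p⟩ T.start ++ ((List.finRange k).flatMap (fun a : Fin k =>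
      word ⟨a, s, 0, S.n, p⟩ T.pre ++ ((List.finRange S.n).flatMap (fun r : Fin S.n =>
        if S.trans s a r then word ⟨a, s, r, S.n, p⟩ T.item else []) ++
          word ⟨a, s, 0, S.n, p⟩ (T.post (S.enabled s a)))) ++
      word ⟨0, s, 0, S.n, p⟩ (T.fin (S.live s))) := by
  rw [Template.rowOut, PreLTS.row, idxFlat_finRange]
  simp only [Template.blockOut, idxFlat_finRange, zero_add, Template.itemOut, List.any_map,
    Function.comp_def, PreLTS.live, PreLTS.enabled, id]

theorem rowOut_diaTemplate (ready : Bool) (j : Fin J) (fin : Bool → List Tok)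
    (φ : Form k (Fin (J * S.n))) (hφ : word ⟨0, s, 0, S.n, p⟩ (fin (S.live s)) = φ.encode) :
    (diaTemplate ready j fin).rowOut ⟨0, 0, 0, S.n, p⟩ s (S.row s) =
      .eqn :: (diaRow S s ready (fun r => .var (idx j r)) φ).encode := by
  rw [rowOut_row]
  simp only [diaTemplate, hφ, word_cons_sym, word_nil, List.nil_append,
    List.cons_append]
  congr 1
  rw [diaRow, encode_foldr]
  intro a ψ
  rw [encode_foldr _ (fun r => if S.trans s a r then word ⟨a, s, r, S.n, p⟩
    (.sym .and :: .sym .dia :: (actTok ++ varTok j .tgt)) else [])]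
  · simp only [word_cons_sym, List.append_assoc]
    congr 1
    split_ifs
    · simp [word_cons_sym, word_append, word_actTok, Form.encode, word_nil]
    · rfl
  · intro r ψ
    split_ifs
    · simp [word_cons_sym, word_append, word_actTok, word_varTok, Form.encode, val_idx, Env.val]
    · rfl

theorem rowOut_muTemplate (neg : Bool) (j : Fin J) (fin : Bool → List Tok)
    (φ : Form k (Fin (J * S.n))) (hφ : word ⟨0, s, 0, S.n, p⟩ (fin (S.live s)) = φ.encode) :
    (muTemplate neg j fin).rowOut ⟨0, 0, 0, S.n, p⟩ s (S.row s) =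
      .eqn :: (muRow S s
        (fun r => if neg then .neg (.var (idx j r)) else .var (idx j r)) φ).encode := by
  rw [rowOut_row]
  simp only [muTemplate, hφ, word_nil, word_cons_sym, List.cons_append,
    List.nil_append]
  congr 1
  rw [muRow, encode_foldr]
  intro a ψ
  rw [Form.encode, Form.encode, encode_foldr _ (fun r => if S.trans s a r then
    .and :: word ⟨a, s, r, S.n, p⟩ ((if neg then [.sym .neg] else []) ++ varTok j .tgt) else [])]
  · simp [word_actTok, Form.encode]
  · intro r ψ
    split_ifs <;>
      simp [word_cons_sym, word_varTok, Form.encode, val_idx, Env.val]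

theorem rowOut_zeroTemplate :
    zeroTemplate.rowOut ⟨0, 0, 0, S.n, p⟩ s (S.row s) =
      .eqn :: (zeroRow k (Fin (J * S.n))).encode := by
  rw [rowOut_row]
  simp only [zeroTemplate, word_nil, word_cons_sym, List.cons_append,
    List.nil_append]
  congr 1
  rw [zeroRow, encode_foldr _ (fun a : Fin k => .and :: .box :: (encodeNum a ++ [.ff]))]
  · have h : ((List.finRange S.n).flatMap fun _ => ([] : List OutSym)) = [] :=
      List.flatMap_eq_nil_iff.2 fun _ _ => rfl
    simp [word_append, word_actTok, Form.encode, word_cons_sym, word_nil, h]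
  · intro a ψ
    simp [Form.encode]

end RowOut

/-! ### Systems of equations -/

theorem subst_congr {k : ℕ} {V W : Type} {σ τ : V → Form k W} (φ : Form k V)
    (h : ∀ v, φ.Occurs v → σ v = τ v) : φ.subst σ = φ.subst τ := by
  induction φ with
  | tt => rfl
  | ff => rfl
  | and φ ψ ih₁ ih₂ =>
    rw [Form.subst, Form.subst, ih₁ fun v hv => h v (.inl hv), ih₂ fun v hv => h v (.inr hv)]
  | or φ ψ ih₁ ih₂ =>
    rw [Form.subst, Form.subst, ih₁ fun v hv => h v (.inl hv), ih₂ fun v hv => h v (.inr hv)]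
  | dia a φ ih => rw [Form.subst, Form.subst, ih h]
  | box a φ ih => rw [Form.subst, Form.subst, ih h]
  | neg φ ih => rw [Form.subst, Form.subst, ih h]
  | var v => exact h v rfl

/-- An acyclic system of equations has a solution. -/
theorem exists_solution {k : ℕ} {V : Type} (R : V → Form k V)
    (hR : WellFounded fun v w => (R w).Occurs v) :
    ∃ σ : V → HML k, ∀ v, σ v = (R v).subst σ := by
  classical
  let F : ∀ w, (∀ v, (R w).Occurs v → HML k) → HML k := fun w rec =>
    (R w).subst fun v => if h : (R w).Occurs v then rec v h else .tt
  refine ⟨hR.fix F, fun v => ?_⟩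
  rw [hR.fix_eq]
  exact subst_congr _ fun w hw => dif_pos hw

/-- In a loop-free system the transitions are well-founded. -/
theorem LTS.wellFounded {k : ℕ} (S : LTS k) :
    WellFounded fun r s : Fin S.n => ∃ a, S.trans s a r = true := by
  have hs : ∀ r s : Fin S.n, Relation.TransGen (fun r s => ∃ a, S.trans s a r = true) r s →
      ∃ t, t ≠ [] ∧ S.Steps s t r := by
    intro r s h
    induction h with
    | single h =>
      obtain ⟨a, ha⟩ := h
      exact ⟨[a], nofun, r, ha, rfl⟩
    | tail _ h ih =>
      obtain ⟨a, ha⟩ := h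
      obtain ⟨t, -, ht⟩ := ih
      exact ⟨a :: t, nofun, _, ha, ht⟩
  have : Std.Irrefl (Relation.TransGen fun r s : Fin S.n => ∃ a, S.trans s a r = true) :=
    ⟨fun s h => by
      obtain ⟨t, hne, ht⟩ := hs s s h
      exact hne (S.loopFree s t ht)⟩
  exact Subrelation.wf (fun h => Relation.TransGen.single h)
    (Finite.wellFounded_of_trans_of_irrefl
      (Relation.TransGen fun r s : Fin S.n => ∃ a, S.trans s a r = true))

/-- Increasing order of the variables is the order family by family, and state by state within a
family. It is the order in which the passes write the equations. -/
theorem flatMap_finRange_mul {γ : Type} {J n : ℕ} (g : Fin (J * n) → List γ) :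
    (List.finRange (J * n)).flatMap g =
      (List.finRange J).flatMap fun j => (List.finRange n).flatMap fun s => g (idx j s) := by
  have h : ∀ j s, idx (J := J) (n := n) j s = ⟨j * n + s, by
      rw [← val_idx]; exact (idx j s).2⟩ := fun j s => Fin.ext (val_idx j s)
  simp only [List.flatMap_def, ← List.ofFn_eq_map, h, List.ofFn_mul]
  simp only [List.flatten_flatten, List.map_ofFn, Function.comp_def]

/-- A family of right-hand sides in the variables that belong to a family and a state. -/
abbrev Families (J : ℕ) {k : ℕ} (S : LTS k) : Type := Fin J → Fin S.n → Form k (Fin (J * S.n))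

/-- The formulae, one for each family and each state, solve the equations. -/
def Solves {J k : ℕ} {S : LTS k} (R : Families J S) (σ : Fin J → Fin S.n → HML k) : Prop :=
  ∀ j s, σ j s = (R j s).subst
    fun i => σ (finProdFinEquiv.symm i).1 (finProdFinEquiv.symm i).2

/-- An equation for the state `s` refers to states that can be reached from `s` in one step, and, in
families that come before, to `s` itself. -/
def Acyclic {J k : ℕ} {S : LTS k} (R : Families J S) : Prop :=
  ∀ j s v, (R j s).Occurs v →
    (∃ j' r a, v = idx j' r ∧ S.trans s a r = true) ∨ ∃ j', j' < j ∧ v = idx j' s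

def familySystem {J k : ℕ} {S : LTS k} (R : Families J S) (j : Fin J) (s : Fin S.n) :
    EqSystem k where
  m := J * S.n
  rhs i := R (finProdFinEquiv.symm i).1 (finProdFinEquiv.symm i).2
  root := idx j s

/-- The state comes first in the lexicographic order: a move to a successor may lead to any family,
even a later one, whereas staying at a state must decrease the family. -/
theorem familySystem_wellFounded {J k : ℕ} {S : LTS k} {R : Families J S} (hR : Acyclic R) :
    WellFounded fun v i : Fin (J * S.n) =>
      (R (finProdFinEquiv.symm i).1 (finProdFinEquiv.symm i).2).Occurs v := by
  have hw : WellFounded (Prod.Lex (fun r s : Fin S.n => ∃ a, S.trans s a r = true)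
      fun j' j : Fin J => j' < j) := S.wellFounded.prod_lex wellFounded_lt
  refine Subrelation.wf (fun {v i} h => ?_) (InvImage.wf (fun i : Fin (J * S.n) =>
    ((finProdFinEquiv.symm i).2, (finProdFinEquiv.symm i).1)) hw)
  obtain ⟨⟨j, s⟩, rfl⟩ := finProdFinEquiv.surjective i
  simp only [Equiv.symm_apply_apply] at h
  rcases hR j s v h with ⟨j', r, a, rfl, ha⟩ | ⟨j', hj, rfl⟩
  · simp only [InvImage, idx, Equiv.symm_apply_apply]
    exact Prod.Lex.left _ _ ⟨a, ha⟩
  · simp only [InvImage, idx, Equiv.symm_apply_apply]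
    exact Prod.Lex.right _ hj

theorem exists_solves {J k : ℕ} {S : LTS k} {R : Families J S} (hR : Acyclic R) :
    ∃ σ, Solves R σ ∧ ∀ j s, (familySystem R j s).IsDeclFormOf (σ j s) := by
  obtain ⟨σ, hσ⟩ := exists_solution _ (familySystem_wellFounded hR)
  have h : Solves R fun j s => σ (idx j s) := by
    intro j s
    have h := hσ (idx j s)
    simp only [idx, Equiv.symm_apply_apply, Prod.mk.eta, Equiv.apply_symm_apply] at h ⊢
    exact h
  exact ⟨_, h, fun j s => ⟨familySystem_wellFounded hR, σ, hσ, rfl⟩⟩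

/-- The words that are written for the index of the distinguished variable. -/
def rootTok (j : ℕ) : List Tok := List.replicate j (.ones .size) ++ [.ones .proc, .sym .endnum]

theorem encode_familySystem {J : ℕ} (p : Input) (R : Families J p.lts) (T : Fin J → Template)
    (hT : ∀ j (s : Fin p.lts.n), (T j).rowOut ⟨0, 0, 0, p.lts.n, p.proc⟩ s (p.lts.row s) =
      .eqn :: (R j s).encode)
    (j : Fin J) :
    templateOut (rootTok j) ((List.finRange J).map T) p = (familySystem R j p.proc).encode := by
  have htab : p.table = (List.finRange p.lts.n).map p.lts.row := rfl
  rw [templateOut, EqSystem.encode, rootTok, word_indexTok]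
  congr 1
  · exact congrArg encodeNum (val_idx j p.proc).symm
  · refine Eq.trans ?_ (flatMap_finRange_mul (J := J) (n := p.lts.n) _).symm
    rw [List.flatMap_map]
    simp only [Template.tableOut, htab, idxFlat_finRange, zero_add, hT, familySystem, idx,
      Equiv.symm_apply_apply]

/-- It suffices to find templates for an acyclic system of equations whose solution is
characteristic. -/
theorem exists_of_families (L : ∀ k, Set (HML k)) {J : ℕ} (j : Fin J) (T : Fin J → Template)
    (R : ∀ {k : ℕ} (S : LTS k), Families J S)
    (hT : ∀ {k : ℕ} (S : LTS k) (p : ℕ) (j) (s : Fin S.n),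
      (T j).rowOut ⟨0, 0, 0, S.n, p⟩ s (S.row s) = .eqn :: (R S j s).encode)
    (hR : ∀ {k : ℕ} (S : LTS k), Acyclic (R S))
    (hL : ∀ {k : ℕ} (S : LTS k) (σ), Solves (R S) σ → ∀ s, IsCharacteristic (L k) S s (σ j s)) :
    ∃ f : Input → List OutSym,
      Nonempty (Turing.TM2ComputableInPolyTime Input.encode id f) ∧
      ∀ p : Input, ∃ (D : EqSystem p.k) (φ : HML p.k),
        f p = D.encode ∧ D.IsDeclFormOf φ ∧ IsCharacteristic (L p.k) p.lts p.proc φ := by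
  refine ⟨_, templateOut_polyTime (rootTok j) ((List.finRange J).map T), fun p => ?_⟩
  obtain ⟨σ, hσ, hD⟩ := exists_solves (hR p.lts)
  exact ⟨familySystem (R p.lts) j p.proc, σ j p.proc,
    encode_familySystem p (R p.lts) T (fun j s => hT p.lts p.proc j s) j, hD j p.proc,
    hL p.lts σ hσ p.proc⟩

/-- If `φ` belongs to `L` and holds at `p`, the inclusion of theories already yields `φ` at `q`;
only the passage from `φ` to the whole theory of `p` has to be proved. -/
theorem isCharacteristic_of {k : ℕ} {L : Set (HML k)} {S : LTS k} {p : Fin S.n} {φ : HML k}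
    (hφ : φ ∈ L) (hp : Sat S p φ)
    (h : ∀ (T : LTS k) (q : Fin T.n), Sat T q φ → ∀ ψ ∈ L, Sat S p ψ → Sat T q ψ) :
    IsCharacteristic L S p φ :=
  ⟨hφ, fun T q => ⟨fun hq _ hψ => ⟨hψ.1, h T q hq _ hψ.1 hψ.2⟩, fun hq => (hq ⟨hφ, hp⟩).2⟩⟩

/-! ### Ready simulation -/

def readyFamilies {k : ℕ} (S : LTS k) : Families 1 S := fun _ s =>
  diaRow S.toPreLTS s true (fun r => .var (idx 0 r)) .tt

theorem acyclic_diaRow {J k : ℕ} {S : LTS k} {s : Fin S.n} {ready : Bool} {j j' : Fin J}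
    {φ : Form k (Fin (J * S.n))} {v : Fin (J * S.n)}
    (h : (diaRow S.toPreLTS s ready (fun r => .var (idx j' r)) φ).Occurs v)
    (hφ : φ.Occurs v → ∃ j', j' < j ∧ v = idx j' s) :
    (∃ j' r a, v = idx j' r ∧ S.trans s a r = true) ∨ ∃ j', j' < j ∧ v = idx j' s := by
  rcases occurs_diaRow h with ⟨a, r, ha, h⟩ | h
  · exact .inl ⟨j', r, a, h.symm, ha⟩
  · exact .inr (hφ h)

theorem solves_var {J n k : ℕ} (σ : Fin J → Fin n → HML k) (j : Fin J) (s : Fin n) :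
    (Form.var (idx j s) : Form k (Fin (J * n))).subst
      (fun i => σ (finProdFinEquiv.symm i).1 (finProdFinEquiv.symm i).2) = σ j s := by
  simp [Form.subst, idx]

theorem exists_readySimulation : ∃ f : Input → List OutSym,
    Nonempty (Turing.TM2ComputableInPolyTime Input.encode id f) ∧
    ∀ p : Input, ∃ (D : EqSystem p.k) (φ : HML p.k), f p = D.encode ∧ D.IsDeclFormOf φ ∧
      IsCharacteristic (Semantics.RS.logic p.k) p.lts p.proc φ := by
  refine exists_of_families (fun k => Semantics.RS.logic k) (0 : Fin 1)
    (fun _ => diaTemplate true 0 fun _ => [.sym .tt]) readyFamilies ?_ ?_ ?_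
  · intro k S p j s
    exact rowOut_diaTemplate S.toPreLTS s p true (0 : Fin 1) _ .tt rfl
  · intro k S j s v h
    exact acyclic_diaRow h False.elim
  · intro k S σ hσ
    replace hσ : ∀ s, σ 0 s = diaRow S.toPreLTS s true (σ 0) .tt := fun s => by
      rw [hσ 0 s, readyFamilies, subst_diaRow]
      simp only [solves_var]
      rfl
    intro s
    refine isCharacteristic_of ?_ ?_ ?_
    · induction s using S.wellFounded.induction with
      | _ s ih =>
        rw [hσ]
        exact diaRow_mem _ _ RSLogic.and RSLogic.dia (fun _ => RSLogic.boxff)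
          (fun a r h => ih r ⟨a, h⟩) RSLogic.tt
    · induction s using S.wellFounded.induction with
      | _ s ih =>
        rw [hσ, sat_diaRow]
        exact ⟨fun a => ⟨fun r h => ⟨r, h, ih r ⟨a, h⟩⟩, fun _ h => h⟩, trivial⟩
    · intro T q hq ψ hψ hs
      -- Induction on `ψ` with `s` and `q` varying: a diamond is carried along a matched move, and
      -- `[a]ff` is preserved because `q` enables no further actions.
      change RSLogic k ψ at hψ
      induction hψ generalizing s q with
      | tt => trivial
      | ff => exact hs
      | and _ _ ih₁ ih₂ => exact ⟨ih₁ s q hq hs.1, ih₂ s q hq hs.2⟩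
      | or _ _ ih₁ ih₂ => exact hs.imp (ih₁ s q hq) (ih₂ s q hq)
      | dia a _ ih =>
        obtain ⟨r, hr, hs⟩ := hs
        rw [hσ, sat_diaRow] at hq
        obtain ⟨q', hq', hX⟩ := (hq.1 a).1 r hr
        exact ⟨q', hq', ih r q' hX hs⟩
      | boxff a =>
        rw [hσ, sat_diaRow] at hq
        have h₁ : S.enabled s a = false := by
          rw [← Bool.not_eq_true, PreLTS.enabled_eq_true]
          rintro ⟨r, hr⟩
          exact hs r hr
        have h₂ := (hq.1 a).2 rfl h₁
        rw [← Bool.not_eq_true, PreLTS.enabled_eq_true] at h₂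
        exact fun t ht => h₂ ⟨t, ht⟩

/-! ### Complete simulation -/

/-- Family 0 is the same formula at every state; it is repeated since a template writes one equation
per state. Only deadlocked states refer to it, since `𝟎` holds at no others. -/
def completeFamilies {k : ℕ} (S : LTS k) : Families 2 S
  | 0, _ => zeroRow k _
  | 1, s => diaRow S.toPreLTS s false (fun r => .var (idx 1 r))
      (if S.live s then .tt else .var (idx 0 s))

theorem exists_completeSimulation : ∃ f : Input → List OutSym,
    Nonempty (Turing.TM2ComputableInPolyTime Input.encode id f) ∧
    ∀ p : Input, ∃ (D : EqSystem p.k) (φ : HML p.k), f p = D.encode ∧ D.IsDeclFormOf φ ∧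
      IsCharacteristic (Semantics.CS.logic p.k) p.lts p.proc φ := by
  refine exists_of_families (fun k => Semantics.CS.logic k) (1 : Fin 2)
    (fun j => if j = 0 then zeroTemplate else
      diaTemplate false 1 fun b => if b then [.sym .tt] else varTok 0 .src) completeFamilies ?_ ?_ ?_
  · intro k S p j s
    match j with
    | 0 => exact rowOut_zeroTemplate S.toPreLTS s p
    | 1 =>
      refine rowOut_diaTemplate S.toPreLTS s p false (1 : Fin 2) _ _ ?_
      cases S.live s
      · simp [word_varTok, Form.encode, val_idx, Env.val]
      · rfl
  · intro k S j s v h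
    match j with
    | 0 => exact (not_occurs_zeroRow h).elim
    | 1 =>
      refine acyclic_diaRow h fun h => ⟨0, Fin.zero_lt_one, ?_⟩
      split_ifs at h
      · exact h.elim
      · exact h.symm
  · intro k S σ hσ
    have hσ₀ : ∀ s, σ 0 s = zeroForm k := fun s => by
      rw [hσ 0 s, completeFamilies, subst_zeroRow]
      rfl
    replace hσ : ∀ s, σ 1 s = diaRow S.toPreLTS s false (σ 1)
        (if S.live s then .tt else zeroForm k) := fun s => by
      rw [hσ 1 s, completeFamilies, subst_diaRow]
      simp only [solves_var]
      congr 1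
      split_ifs
      · rfl
      · rw [solves_var, hσ₀]
    intro s
    refine isCharacteristic_of ?_ ?_ ?_
    · induction s using S.wellFounded.induction with
      | _ s ih =>
        rw [hσ]
        refine diaRow_mem _ _ CSLogic.and CSLogic.dia nofun (fun a r h => ih r ⟨a, h⟩) ?_
        split_ifs
        · exact CSLogic.tt
        · exact CSLogic.zero
    · induction s using S.wellFounded.induction with
      | _ s ih =>
        rw [hσ, sat_diaRow]
        refine ⟨fun a => ⟨fun r h => ⟨r, h, ih r ⟨a, h⟩⟩, fun _ h => h⟩, ?_⟩
        split_ifs with h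
        · trivial
        · exact sat_zeroForm.2 (by simpa using h)
    · intro T q hq ψ hψ hs
      change CSLogic k ψ at hψ
      induction hψ generalizing s q with
      | tt => trivial
      | ff => exact hs
      | and _ _ ih₁ ih₂ => exact ⟨ih₁ s q hq hs.1, ih₂ s q hq hs.2⟩
      | or _ _ ih₁ ih₂ => exact hs.imp (ih₁ s q hq) (ih₂ s q hq)
      | dia a _ ih =>
        obtain ⟨r, hr, hs⟩ := hs
        rw [hσ, sat_diaRow] at hq
        obtain ⟨q', hq', hX⟩ := (hq.1 a).1 r hr
        exact ⟨q', hq', ih r q' hX hs⟩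
      | zero =>
        -- As `s` satisfies `𝟎` it is not live, so the last conjunct of its equation is `𝟎`.
        rw [hσ, sat_diaRow, sat_zeroForm.1 hs] at hq
        exact hq.2

/-! ### Bisimilarity -/

/-- Family 0 expresses that the process has a move matched by no move of `s`. Its negation in family
1 is the backward half of the bisimulation condition, and the references back to family 1 go to
successors only. -/
def bisimFamilies {k : ℕ} (S : LTS k) : Families 2 S
  | 0, s => muRow S.toPreLTS s (fun r => .neg (.var (idx 1 r))) .ff
  | 1, s => diaRow S.toPreLTS s false (fun r => .var (idx 1 r)) (.neg (.var (idx 0 s)))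

theorem exists_bisimilarity : ∃ f : Input → List OutSym,
    Nonempty (Turing.TM2ComputableInPolyTime Input.encode id f) ∧
    ∀ p : Input, ∃ (D : EqSystem p.k) (φ : HML p.k), f p = D.encode ∧ D.IsDeclFormOf φ ∧
      IsCharacteristic (Semantics.BS.logic p.k) p.lts p.proc φ := by
  refine exists_of_families (fun k => Semantics.BS.logic k) (1 : Fin 2)
    (fun j => if j = 0 then muTemplate true 1 fun _ => [.sym .ff] else
      diaTemplate false 1 fun _ => .sym .neg :: varTok 0 .src) bisimFamilies ?_ ?_ ?_
  · intro k S p j s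
    match j with
    | 0 => exact rowOut_muTemplate S.toPreLTS s p true (1 : Fin 2) _ .ff rfl
    | 1 =>
      refine rowOut_diaTemplate S.toPreLTS s p false (1 : Fin 2) _ _ ?_
      simp [word_cons_sym, word_varTok, Form.encode, val_idx, Env.val]
  · intro k S j s v h
    match j with
    | 0 =>
      rcases occurs_muRow h with ⟨a, r, ha, h⟩ | h
      · exact .inl ⟨1, r, a, h.symm, ha⟩
      · exact h.elim
    | 1 => exact acyclic_diaRow h fun h => ⟨0, Fin.zero_lt_one, h.symm⟩
  · intro k S σ hσ
    have hσ₀ : ∀ s, σ 0 s = muRow S.toPreLTS s (fun r => .neg (σ 1 r)) .ff := fun s => by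
      rw [hσ 0 s, bisimFamilies, subst_muRow]
      -- `Form.subst.eq_7` is the defining equation for negation.
      simp only [Form.subst.eq_7, solves_var]
      rfl
    replace hσ : ∀ s, σ 1 s = diaRow S.toPreLTS s false (σ 1) (.neg (σ 0 s)) := fun s => by
      rw [hσ 1 s, bisimFamilies, subst_diaRow]
      simp only [Form.subst.eq_7, solves_var]
    have hsat : ∀ (s : Fin S.n) (T : LTS k) (q : Fin T.n), Sat T q (σ 1 s) ↔
        (∀ a r, S.trans s a r = true → ∃ q', T.trans q a q' = true ∧ Sat T q' (σ 1 r)) ∧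
        ∀ a q', T.trans q a q' = true → ∃ r, S.trans s a r = true ∧ Sat T q' (σ 1 r) := by
      intro s T q
      rw [hσ, sat_diaRow, Sat, hσ₀, sat_muRow]
      simp [Sat]
    intro s
    refine isCharacteristic_of trivial ?_ ?_
    · induction s using S.wellFounded.induction with
      | _ s ih =>
        rw [hsat]
        exact ⟨fun a r h => ⟨r, h, ih r ⟨a, h⟩⟩, fun a r h => ⟨r, h, ih r ⟨a, h⟩⟩⟩
    · intro T q hq ψ hψ hs
      -- Negation exchanges the two directions, so the induction needs the equivalence.
      refine (?_ : Sat S s ψ ↔ Sat T q ψ).1 hs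
      clear hs hψ
      induction ψ generalizing s q with
      | tt => rfl
      | ff => rfl
      | and _ _ ih₁ ih₂ => exact and_congr (ih₁ s q hq) (ih₂ s q hq)
      | or _ _ ih₁ ih₂ => exact or_congr (ih₁ s q hq) (ih₂ s q hq)
      | dia a φ ih =>
        obtain ⟨h₁, h₂⟩ := (hsat s T q).1 hq
        constructor
        · rintro ⟨r, hr, hs⟩
          obtain ⟨q', hq', hX⟩ := h₁ a r hr
          exact ⟨q', hq', (ih r q' hX).1 hs⟩
        · rintro ⟨q', hq', hs⟩
          obtain ⟨r, hr, hX⟩ := h₂ a q' hq'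
          exact ⟨r, hr, (ih r q' hX).2 hs⟩
      | box a φ ih =>
        obtain ⟨h₁, h₂⟩ := (hsat s T q).1 hq
        constructor
        · intro hs q' hq'
          obtain ⟨r, hr, hX⟩ := h₂ a q' hq'
          exact (ih r q' hX).1 (hs r hr)
        · intro hs r hr
          obtain ⟨q', hq', hX⟩ := h₁ a r hr
          exact (ih r q' hX).2 (hs q' hq')
      | neg φ ih => exact not_congr (ih s q hq)
      | var v => exact v.elim

/-! ### Nested simulation -/

/-- The last disjunct or conjunct of the equations for nested simulation. -/
def nestedEnd {k N : ℕ} (S : LTS k) (pol : Bool) (s : Fin S.n) :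
    Fin N → Form k (Fin (N * S.n))
  | ⟨0, _⟩ => if pol then .tt else .ff
  | ⟨i + 1, h⟩ => .neg (.var (idx ⟨i, by omega⟩ s))

/-- The polarity of a family: the last one is positive, and the polarities alternate. -/
def polarity (N i : ℕ) : Bool := (i + N).bodd

/-- The equations for nested simulation: at a positive level the formula for `s` says that `s` is
below the process at hand, at a negative level that the process is not below `s`. -/
def nestedFamilies (N : ℕ) {k : ℕ} (S : LTS k) : Families N S := fun i s =>
  if polarity N i then
    diaRow S.toPreLTS s false (fun r => .var (idx i r)) (nestedEnd S true s i)
  else muRow S.toPreLTS s (fun r => .var (idx i r)) (nestedEnd S false s i)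

def nestedEndTok (pol : Bool) : ℕ → List Tok
  | 0 => if pol then [.sym .tt] else [.sym .ff]
  | i + 1 => .sym .neg :: varTok i .src

def nestedTemplate (N i : ℕ) : Template :=
  if polarity N i then diaTemplate false i fun _ => nestedEndTok true i
  else muTemplate false i fun _ => nestedEndTok false i

theorem word_nestedEndTok {k N : ℕ} (S : LTS k) (pol : Bool) (s : Fin S.n) (i : Fin N) (p : ℕ) :
    word ⟨0, s, 0, S.n, p⟩ (nestedEndTok pol i) = (nestedEnd S pol s i).encode := by
  match i with
  | ⟨0, _⟩ => cases pol <;> rfl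
  | ⟨i + 1, h⟩ =>
    simp [nestedEndTok, nestedEnd, word_cons_sym, word_varTok, Form.encode, val_idx, Env.val]

theorem rowOut_nestedTemplate {k N : ℕ} (S : LTS k) (p : ℕ) (i : Fin N) (s : Fin S.n) :
    (nestedTemplate N i).rowOut ⟨0, 0, 0, S.n, p⟩ s (S.row s) =
      .eqn :: (nestedFamilies N S i s).encode := by
  rw [nestedTemplate, nestedFamilies]
  split_ifs
  · exact rowOut_diaTemplate S.toPreLTS s p false i _ _ (word_nestedEndTok S true s i p)
  · exact rowOut_muTemplate S.toPreLTS s p false i _ _ (word_nestedEndTok S false s i p)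

theorem occurs_nestedEnd {k N : ℕ} {S : LTS k} {pol : Bool} {s : Fin S.n} {i : Fin N}
    {v : Fin (N * S.n)} (h : (nestedEnd S pol s i).Occurs v) : ∃ j, j < i ∧ v = idx j s := by
  match i, h with
  | ⟨0, _⟩, h =>
    simp only [nestedEnd] at h
    split_ifs at h <;> exact h.elim
  | ⟨i + 1, _⟩, h => exact ⟨⟨i, by omega⟩, Nat.lt_succ_self i, h.symm⟩

theorem acyclic_nestedFamilies (N : ℕ) {k : ℕ} (S : LTS k) : Acyclic (nestedFamilies N S) := by
  intro i s v h
  rw [nestedFamilies] at h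
  split_ifs at h
  · exact acyclic_diaRow h occurs_nestedEnd
  · rcases occurs_muRow h with ⟨a, r, ha, h⟩ | h
    · exact .inl ⟨i, r, a, h.symm, ha⟩
    · exact .inr (occurs_nestedEnd h)

/-- What is expected of the solution `σ` of the equations at the level `i`. -/
structure NestedSpec {k N : ℕ} (S : LTS k) (i : ℕ) (σ : Fin S.n → HML k) : Prop where
  mem : ∀ s, NestedLogic k (i + 1) (σ s)
  pos : polarity N i = true → ∀ s, Sat S s (σ s) ∧ ∀ (T : LTS k) (q : Fin T.n), Sat T q (σ s) →
    ∀ φ, NestedLogic k (i + 1) φ → Sat S s φ → Sat T q φ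
  neg : polarity N i = false → ∀ s, ¬ Sat S s (σ s) ∧ ∀ (T : LTS k) (q : Fin T.n), ¬ Sat T q (σ s) →
    ∀ φ, NestedLogic k (i + 1) φ → Sat T q φ → Sat S s φ

/-- The solution of an equation of positive polarity is as expected. -/
theorem nestedSpec_of_diaRow {k N : ℕ} {S : LTS k} {i : ℕ} {σ ε : Fin S.n → HML k}
    (hp : polarity N i = true)
    (hσ : ∀ s, σ s = diaRow S.toPreLTS s false σ (ε s))
    (hε : ∀ s, NestedLogic k (i + 1) (ε s)) (hs : ∀ s, Sat S s (ε s))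
    (hneg : ∀ s (T : LTS k) (q : Fin T.n), Sat T q (ε s) → ∀ j, i = j + 1 →
      ∀ φ, NestedLogic k (j + 1) φ → Sat T q φ → Sat S s φ) : NestedSpec (N := N) S i σ where
  mem s := by
    induction s using S.wellFounded.induction with
    | _ s ih =>
      rw [hσ]
      exact diaRow_mem _ _ NestedLogic.and NestedLogic.dia nofun (fun a r h => ih r ⟨a, h⟩) (hε s)
  neg h := by rw [hp] at h; exact absurd h nofun
  pos _ := by
    intro s
    constructor
    · induction s using S.wellFounded.induction with
      | _ s ih =>
        rw [hσ, sat_diaRow]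
        exact ⟨fun a => ⟨fun r h => ⟨r, h, ih r ⟨a, h⟩⟩, fun _ h => h⟩, hs s⟩
    · intro T q hq φ hφ hsφ
      generalize hm : i + 1 = m at hφ
      induction hφ generalizing s q with
      | tt => trivial
      | ff => exact hsφ
      | and _ _ ih₁ ih₂ => exact ⟨ih₁ s q hq hsφ.1 hm, ih₂ s q hq hsφ.2 hm⟩
      | or _ _ ih₁ ih₂ => exact hsφ.imp (ih₁ s q hq · hm) (ih₂ s q hq · hm)
      | dia a _ ih =>
        obtain ⟨r, hr, hsφ⟩ := hsφ
        rw [hσ, sat_diaRow] at hq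
        obtain ⟨q', hq', hX⟩ := (hq.1 a).1 r hr
        exact ⟨q', hq', ih r q' hX hsφ hm⟩
      -- A negated formula lies one level lower, where the end formula `ε s` provides the inclusion
      -- of theories in the opposite direction.
      | @neg n φ hn hφ _ =>
        obtain ⟨j, rfl⟩ : ∃ j, n = j + 1 := ⟨n - 1, by omega⟩
        rw [hσ, sat_diaRow] at hq
        exact fun hqφ => hsφ (hneg s T q hq.2 j (by omega) φ hφ hqφ)

/-- The solution of an equation of negative polarity is as expected. -/
theorem nestedSpec_of_muRow {k N : ℕ} {S : LTS k} {i : ℕ} {σ ε : Fin S.n → HML k}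
    (hp : polarity N i = false)
    (hσ : ∀ s, σ s = muRow S.toPreLTS s σ (ε s))
    (hε : ∀ s, NestedLogic k (i + 1) (ε s)) (hs : ∀ s, ¬ Sat S s (ε s))
    (hpos : ∀ s (T : LTS k) (q : Fin T.n), ¬ Sat T q (ε s) → ∀ j, i = j + 1 →
      ∀ φ, NestedLogic k (j + 1) φ → Sat S s φ → Sat T q φ) : NestedSpec (N := N) S i σ where
  mem s := by
    induction s using S.wellFounded.induction with
    | _ s ih =>
      rw [hσ]
      exact muRow_mem _ _ (.tt _) NestedLogic.and NestedLogic.or NestedLogic.dia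
        (fun a r h => ih r ⟨a, h⟩) (hε s)
  pos h := by rw [hp] at h; exact absurd h nofun
  neg _ := by
    intro s
    constructor
    · induction s using S.wellFounded.induction with
      | _ s ih =>
        rw [hσ, sat_muRow]
        rintro (⟨a, r, hr, h⟩ | h)
        · exact ih r ⟨a, hr⟩ (h r hr)
        · exact hs s h
    · intro T q hq φ hφ hqφ
      generalize hm : i + 1 = m at hφ
      induction hφ generalizing s q with
      | tt => trivial
      | ff => exact hqφ
      | and _ _ ih₁ ih₂ => exact ⟨ih₁ s q hq hqφ.1 hm, ih₂ s q hq hqφ.2 hm⟩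
      | or _ _ ih₁ ih₂ => exact hqφ.imp (ih₁ s q hq · hm) (ih₂ s q hq · hm)
      | dia a _ ih =>
        obtain ⟨q', hq', hqφ⟩ := hqφ
        rw [hσ, sat_muRow] at hq
        push Not at hq
        obtain ⟨r, hr, hX⟩ := hq.1 a q' hq'
        exact ⟨r, hr, ih r q' hX hqφ hm⟩
      | @neg n φ hn hφ _ =>
        obtain ⟨j, rfl⟩ : ∃ j, n = j + 1 := ⟨n - 1, by omega⟩
        rw [hσ, sat_muRow] at hq
        push Not at hq
        exact fun hsφ => hqφ (hpos s T q hq.2 j (by omega) φ hφ hsφ)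

/-- Recursion on the level. The end of an equation is the negated variable of the level below, which
has the opposite polarity; its specification is therefore just the opposite inclusion that the
current level needs. At level 0 there are no negated formulae to transfer, and the neutral constant
suffices. -/
theorem nestedSpec_of_solves {k N : ℕ} {S : LTS k} {σ : Fin N → Fin S.n → HML k}
    (hσ : Solves (nestedFamilies N S) σ) (i : ℕ) (hi : i < N) :
    NestedSpec (N := N) S i (σ ⟨i, hi⟩) := by
  have hend : ∀ (pol : Bool) (s : Fin S.n), (nestedEnd S pol s (⟨i, hi⟩ : Fin N)).subst
      (fun i => σ (finProdFinEquiv.symm i).1 (finProdFinEquiv.symm i).2) =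
      match i, hi with
      | 0, _ => if pol then .tt else .ff
      | i + 1, h => .neg (σ ⟨i, by omega⟩ s) := by
    intro pol s
    match i, hi with
    | 0, _ => cases pol <;> rfl
    | i + 1, _ => exact congrArg Form.neg (solves_var σ _ s)
  cases hp : polarity N i with
  | true =>
    have hσ' : ∀ s, σ ⟨i, hi⟩ s = _ := fun s => hσ ⟨i, hi⟩ s
    simp only [nestedFamilies, hp, if_true, subst_diaRow, solves_var, hend] at hσ'
    refine nestedSpec_of_diaRow hp hσ' ?_ ?_ ?_
    all_goals match i, hi with
    | 0, _ => ?_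
    | i + 1, h => ?_
    · exact fun _ => .tt _
    · exact fun s => .neg (by omega) ((nestedSpec_of_solves hσ i (by omega)).mem s)
    · exact fun _ => trivial
    · have hpi : polarity N i = false := by
        simpa [polarity, Nat.add_right_comm] using hp
      exact fun s => (((nestedSpec_of_solves hσ i (by omega)).neg hpi) s).1
    · exact fun _ _ _ _ j hj => absurd hj (by omega)
    · have hpi : polarity N i = false := by
        simpa [polarity, Nat.add_right_comm] using hp
      intro s T q hq j hj
      obtain rfl : i = j := by omega
      exact (((nestedSpec_of_solves hσ i (by omega)).neg hpi) s).2 T q hq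
  | false =>
    have hσ' : ∀ s, σ ⟨i, hi⟩ s = _ := fun s => hσ ⟨i, hi⟩ s
    simp only [nestedFamilies, hp, Bool.false_eq_true, if_false, subst_muRow, solves_var, hend]
      at hσ'
    refine nestedSpec_of_muRow hp hσ' ?_ ?_ ?_
    all_goals match i, hi with
    | 0, _ => ?_
    | i + 1, h => ?_
    · exact fun _ => .ff _
    · exact fun s => .neg (by omega) ((nestedSpec_of_solves hσ i (by omega)).mem s)
    · exact fun _ => id
    · have hpi : polarity N i = true := by
        simpa [polarity, Nat.add_right_comm] using hp
      exact fun s h => h (((nestedSpec_of_solves hσ i (by omega)).pos hpi) s).1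
    · exact fun _ _ _ _ j hj => absurd hj (by omega)
    · have hpi : polarity N i = true := by
        simpa [polarity, Nat.add_right_comm] using hp
      intro s T q hq j hj
      obtain rfl : i = j := by omega
      exact (((nestedSpec_of_solves hσ i (by omega)).pos hpi) s).2 T q (not_not.1 hq)

theorem exists_nestedSimulation (n : ℕ+) : ∃ f : Input → List OutSym,
    Nonempty (Turing.TM2ComputableInPolyTime Input.encode id f) ∧
    ∀ p : Input, ∃ (D : EqSystem p.k) (φ : HML p.k), f p = D.encode ∧ D.IsDeclFormOf φ ∧
      IsCharacteristic ((Semantics.nS n).logic p.k) p.lts p.proc φ := by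
  -- Families are counted from 0 and logics from 1: the logic of level `i + 1` belongs to family
  -- `i`, the last of `i + 1` families.
  obtain ⟨i, hi⟩ : ∃ i, (n : ℕ) = i + 1 := ⟨n - 1, by have := n.pos; omega⟩
  have hlog : ∀ k φ, φ ∈ (Semantics.nS n).logic k ↔ NestedLogic k (i + 1) φ := by
    intro k φ
    rw [← hi]
    rfl
  have hpol : polarity (i + 1) i = true := by
    simp [polarity, Nat.bodd_add]
  refine exists_of_families (fun k => (Semantics.nS n).logic k) (Fin.last i)
    (fun j => nestedTemplate (i + 1) j) (nestedFamilies (i + 1))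
    (fun S p j s => rowOut_nestedTemplate S p j s) (acyclic_nestedFamilies (i + 1)) ?_
  intro k S σ hσ s
  have h := nestedSpec_of_solves hσ i (Nat.lt_succ_self i)
  obtain ⟨h₁, h₂⟩ := h.pos hpol s
  exact isCharacteristic_of ((hlog k _).2 (h.mem s)) h₁
    fun T q hq ψ hψ => h₂ T q hq ψ ((hlog k ψ).1 hψ)

end CharForm

theorem mainTheorem9 (X : CharForm.Semantics) :
    ∃ f : CharForm.Input → List CharForm.OutSym,
      Nonempty (Turing.TM2ComputableInPolyTime CharForm.Input.encode id f) ∧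
      ∀ p : CharForm.Input, ∃ (D : CharForm.EqSystem p.k) (φ : CharForm.HML p.k),
        f p = D.encode ∧ D.IsDeclFormOf φ ∧
          CharForm.IsCharacteristic (X.logic p.k) p.lts p.proc φ := by
  cases X with
  | nS n => exact CharForm.exists_nestedSimulation n
  | CS => exact CharForm.exists_completeSimulation
  | RS => exact CharForm.exists_readySimulation
  | BS => exact CharForm.exists_bisimilarity
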